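/- **Conventions.** All graphs are finite. In the game of *graph take-away* two players alternately delete either an edge, or a vertex together with all its incident edges; the player removing the last vertex wins. The *nim-value* $n(G)$ of a graph $G$ is defined recursively by $n(G)=\operatorname{mex}\{n(G_1),\dots,n(G_m)\}$, where $G_1,\dots,G_m$ are the graphs reachable from $G$ in one move and $\operatorname{mex}$ is the least non-negative integer not in the set (so the empty graph has nim-value $0$). Put $$\varphi(G)=\bigl(|V(G)| \bmod 2\bigr)+2\,\bigl(|E(G)|\bmod 2\bigr)\in\{0,1,2,3\}.$$ *Reduction.* Suppose $G$ is obtained from disjoint graphs $G',H_1,H_2$, where $s$ is a vertex of $G'$ and $H_1\cong H_2$ by an isomorphism taking a vertex $v_1$ of $H_1$ to a vertex $v_2$ of $H_2$, by adding the two edges $sv_1$ and $sv_2$. Then $G$ has a *cancellation* at $s$, and cancelling replaces $G$ by $G'$. A graph is *reduced* if it has no cancellation; to *reduce* a graph is to cancel repeatedly until no cancellation is possible. *Telescoping vertices.* Let $C$ be an odd cycle of $G$, and suppose it is the only cycle of $G$. For a vertex $A$ of $C$, let $T_A$ be the tree attached to $C$ at $A$, that is, the connected component of $A$ in the graph $G$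 with the edges of $C$ removed. A vertex $t$ of $T_A$ is *telescoping* if, when $t$ is deleted from $G$ and the resulting graph is reduced, the only vertex of $T_A$ that remains and is still connected to the cycle is $A$ itself (in particular, $A$ remains). **Corollary 1.4.** Let $G$ be a finite, reduced, possibly disconnected graph with no loops that contains exactly one cycle $C$ (cycles of length $2$, formed by multiple edges, count as cycles, so $G$ is simple), and let $C$ have odd length. Then $n(G)=0$ if and only if one of the following three conditions holds: 1. every vertex of $C$ has degree $2$ in $G$, and $\varphi(G)=3$; 2. exactly one vertex of $C$ has degree greater than $2$ in $G$, $\varphi(G)=0$, and $G$ has no telescoping vertex of odd degree in $G$; 3. at least two vertices of $C$ have degree greater than $2$ in $G$, and $\varphi(G)=0$. -/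

import Mathlib

namespace GraphTakeAway

/-! The game is played on a finite graph `G`; its positions are the subgraphs of `G`
(a set of remaining vertices together with remaining edges between them). A graph without loops
and without cycles of length two is simple, so `SimpleGraph` is the right ambient notion. -/

variable {V : Type*} {G : SimpleGraph V}

/-- `IsMove H K`: the position `K` arises from `H` by deleting one edge, or by deleting one vertex
together with all its incident edges. -/
def IsMove (H K : G.Subgraph) : Prop :=
  (∃ v ∈ H.verts, K = H.deleteVerts {v}) ∨ (∃ e ∈ H.edgeSet, K = H.deleteEdges {e})

theorem IsMove.lt {H K : G.Subgraph} (h : IsMove H K) : K < H := by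
  rcases h with ⟨v, hv, rfl⟩ | ⟨e, he, rfl⟩
  · refine lt_of_le_of_ne SimpleGraph.Subgraph.deleteVerts_le fun heq => ?_
    rw [← heq] at hv
    simp at hv
  · refine lt_of_le_of_ne (SimpleGraph.Subgraph.deleteEdges_le _) fun heq => ?_
    rw [← heq] at he
    induction e with
    | _ a b => simp at he

/-- The minimal natural number excluded from a set. -/
noncomputable def mex (S : Set ℕ) : ℕ := sInf Sᶜ

/-- The nim-value of a position: the `mex` of the nim-values of its options. -/
noncomputable def nimValue [Finite V] (H : G.Subgraph) : ℕ :=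
  mex (Set.range fun K : {K : G.Subgraph // IsMove H K} => nimValue K.1)
termination_by wellFounded_lt.wrap H
decreasing_by exact K.2.lt

/-- The parity function `φ(H) = (|V(H)| mod 2) + 2 (|E(H)| mod 2)`. -/
noncomputable def parity (H : G.Subgraph) : ℕ :=
  H.verts.ncard % 2 + 2 * (H.edgeSet.ncard % 2)

/-- One cancellation leads from `H` to `H'`: there are a vertex `s` of `H` and disjoint isomorphic
parts of `H`, on the vertex sets `S₁` and `S₂` not containing `s`, with corresponding vertices
`v₁` and `v₂`, such that `S₁` is joined to the rest of `H` only by the edge `s v₁`, and `S₂` only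
by the edge `s v₂`; and `H'` is what remains of `H` when both parts are removed. -/
def CancelsTo (H H' : G.Subgraph) : Prop :=
  ∃ (s v₁ v₂ : V) (S₁ S₂ : Set V) (h₁ : v₁ ∈ S₁) (h₂ : v₂ ∈ S₂),
    S₁ ⊆ H.verts ∧ S₂ ⊆ H.verts ∧ Disjoint S₁ S₂ ∧ s ∉ S₁ ∧ s ∉ S₂ ∧
    H.Adj s v₁ ∧ H.Adj s v₂ ∧
    (∀ x ∈ S₁, ∀ y ∉ S₁, H.Adj x y → x = v₁ ∧ y = s) ∧
    (∀ x ∈ S₂, ∀ y ∉ S₂, H.Adj x y → x = v₂ ∧ y = s) ∧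
    (∃ f : (H.induce S₁).coe ≃g (H.induce S₂).coe, f ⟨v₁, h₁⟩ = ⟨v₂, h₂⟩) ∧
    H' = H.deleteVerts (S₁ ∪ S₂)

/-- A graph is reduced if no cancellation is possible. -/
def IsReduced (H : G.Subgraph) : Prop := ¬ ∃ H', CancelsTo H H'

/-- `K` is obtained by reducing `H`: by cancelling until no cancellation is possible. -/
def ReducesTo (H K : G.Subgraph) : Prop := Relation.ReflTransGen CancelsTo H K ∧ IsReduced K

/-- The vertices of the graph attached to the cycle `C` at its vertex `A` (a tree, when `C` is the
only cycle): those that can be reached from `A` without using an edge of `C`. -/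
def attachedTree (C : G.Subgraph) (A : V) : Set V :=
  {x | (G.deleteEdges C.edgeSet).Reachable A x}

/-- The vertices remaining in `K` that are still connected in `K` to a vertex of `C`. -/
def connectedTo (C K : G.Subgraph) : Set V :=
  {x | x ∈ K.verts ∧ ∃ c ∈ C.verts, c ∈ K.verts ∧ K.spanningCoe.Reachable x c}

/-- The vertex `t` is telescoping, for the cycle `C` of `G`: it belongs to the tree attached to `C`
at some vertex `A`, and when `t` is deleted and the resulting graph is reduced, all that remains of
this tree that is still connected to `C` is `A`. -/
def IsTelescoping (C : G.Subgraph) (t : V) : Prop :=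
  ∃ A ∈ C.verts, t ∈ attachedTree C A ∧
    ∃ K, ReducesTo ((⊤ : G.Subgraph).deleteVerts {t}) K ∧
      attachedTree C A ∩ connectedTo C K = {A}

end GraphTakeAway

open GraphTakeAway

set_option linter.unusedSectionVars false

namespace GraphTakeAway

/-! The positions of nim-value zero are determined by exhibiting a kernel: a set of positions with
no move inside it, reachable by one move from everywhere outside it.

On forests the kernel is given by parities alone: the numbers of vertices and edges are both even.
With an odd number of vertices, a vertex of even degree exists by the handshake lemma, and if the
number of edges is odd, a vertex of odd degree exists because a forest is bipartite. A bare odd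
cycle breaks this pattern: both numbers are odd, but no vertex has odd degree. The trees attached to
the cycle decide how far the exception extends.

A rooted tree is coded by a natural number, as in Ackermann's coding of hereditarily finite sets:
the code is the nim sum of `2 ^ c` over the codes `c` of the branches at the root. Branches with
equal codes cancel, so the code is that of the reduced tree. Deleting a non-root vertex of odd
degree, which has an even number of children, changes the code of its parent by `2 ^ e`, where `e`
has an even number of binary digits. A change from `r` to `s` at a vertex then becomes the change `2
^ r + 2 ^ s` at its parent. The differences so generated are the odd shifts (`OddShift`).
Conversely, every odd shift that lowers a code comes from such a deletion (`exists_deletion`).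

The kernel `ZeroPosition` consists of the even-even positions, subject to `Sturdy` if the cycle
survives, and the odd-odd positions that contain the cycle with all codes on it zero. `Sturdy`
excludes exactly the even-even positions whose trees are all trivial, or become so by one odd shift.
The hardest case is an odd-odd position whose cycle vertices all have even degree: a nontrivial tree
must be changed to a nonzero code that is no odd shift, which is the arithmetic of
`exists_lt_not_oddShift`.

Finally, cancellation preserves the codes on the cycle (`cancelsTo_invariant`), and in a reduced
graph a code vanishes only if there are no children. So nonzero codes on the cycle mean degree
greater than two, and codes that are odd shifts mean telescoping vertices of odd degree. -/

/-- The natural numbers, with bitwise exclusive or as addition. -/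
def XorNat : Type := ℕ

/-! ### Nim addition and binary digits -/

namespace XorNat

/-- The underlying natural number. -/
def toNat (a : XorNat) : ℕ := a

/-- A natural number as an element of `XorNat`. -/
def ofNat (a : ℕ) : XorNat := a

instance : LinearOrder XorNat := inferInstanceAs (LinearOrder ℕ)

instance : WellFoundedLT XorNat := inferInstanceAs (WellFoundedLT ℕ)

instance : LocallyFiniteOrderBot XorNat := inferInstanceAs (LocallyFiniteOrderBot ℕ)

instance : Zero XorNat := ⟨ofNat 0⟩

instance : Add XorNat := ⟨fun a b => ofNat (a.toNat ^^^ b.toNat)⟩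

instance : Neg XorNat := ⟨id⟩

instance : AddCommGroup XorNat where
  add_assoc := Nat.xor_assoc
  zero_add := Nat.zero_xor
  add_zero := Nat.xor_zero
  add_comm := Nat.xor_comm
  neg_add_cancel := Nat.xor_self
  nsmul := nsmulRec
  zsmul := zsmulRec

theorem add_self (a : XorNat) : a + a = 0 := Nat.xor_self a

theorem add_add_cancel_left (a b : XorNat) : a + (a + b) = b := by
  rw [← add_assoc, add_self, zero_add]

theorem add_add_cancel_right (a b : XorNat) : a + b + b = a := by
  rw [add_assoc, add_self, add_zero]

theorem add_eq_iff {a b c : XorNat} : a + b = c ↔ b = a + c :=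
  ⟨fun h => by rw [← h, add_add_cancel_left], fun h => by rw [h, add_add_cancel_left]⟩

theorem add_eq_zero {a b : XorNat} : a + b = 0 ↔ a = b := by
  rw [add_eq_iff, add_zero, eq_comm]

theorem pos_iff {a : XorNat} : 0 < a ↔ a ≠ 0 := Nat.pos_iff_ne_zero

theorem lt_add_cases {a b c : XorNat} (h : a < b + c) : a + c < b ∨ a + b < c :=
  Nat.lt_xor_cases h

/-- The binary digit of `a` of index `i`. -/
def digit (a i : XorNat) : Bool := Nat.testBit a.toNat i.toNat

theorem digit_add (a b i : XorNat) : digit (a + b) i = (digit a i ^^ digit b i) :=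
  Nat.testBit_xor a.toNat b.toNat i.toNat

theorem digit_zero (i : XorNat) : digit 0 i = false := Nat.zero_testBit i.toNat

theorem lt_of_digit {a i : XorNat} (h : digit a i = true) : i < a := by
  have h1 : 2 ^ i.toNat ≤ a.toNat := Nat.ge_two_pow_of_testBit h
  exact lt_of_lt_of_le (Nat.lt_two_pow_self (n := i.toNat)) h1

theorem ext_digit {a b : XorNat} (h : ∀ i, digit a i = digit b i) : a = b :=
  Nat.eq_of_testBit_eq h

theorem exists_digit {a : XorNat} (h : a ≠ 0) : ∃ i, digit a i = true := by
  by_contra! hc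
  exact h (ext_digit fun i => by simpa [digit_zero] using hc i)

/-- The number with the single binary digit of index `i`. -/
def bit (i : XorNat) : XorNat := ofNat (2 ^ i.toNat)

theorem digit_bit (i j : XorNat) : digit (bit i) j = true ↔ i = j := by
  change Nat.testBit (2 ^ i.toNat) j.toNat = true ↔ _
  rw [Nat.testBit_two_pow]
  exact decide_eq_true_iff

theorem bit_injective : Function.Injective bit := fun i j h => by
  rw [← digit_bit, h, digit_bit]

theorem bit_ne_zero (i : XorNat) : bit i ≠ 0 := fun h => by
  have := (digit_bit i i).2 rfl
  rw [h, digit_zero] at this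
  simp at this

theorem lt_of_digit_of_digit {a b i : XorNat} (ha : digit a i = false) (hb : digit b i = true)
    (h : ∀ j, i < j → digit a j = digit b j) : a < b :=
  Nat.lt_of_testBit i.toNat ha hb h

theorem digit_bit_of_ne {i j : XorNat} (h : i ≠ j) : digit (bit i) j = false := by
  rw [Bool.eq_false_iff, Ne, digit_bit]; exact h

theorem lt_bit (i : XorNat) : i < bit i := Nat.lt_two_pow_self (n := i.toNat)

/-- The index `i` is that of the highest digit of `b`, hence the highest place where `a` and `a + b`
differ. -/
theorem add_lt_iff_digit {a b i : XorNat} (hi : digit b i = true)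
    (hj : ∀ j, i < j → digit b j = false) : a + b < a ↔ digit a i = true := by
  have hk : ∀ k, i < k → digit (a + b) k = digit a k := fun k hk => by
    rw [digit_add, hj k hk, Bool.xor_false]
  constructor
  · intro hlt
    by_contra hn
    rw [Bool.not_eq_true] at hn
    exact hlt.not_gt (lt_of_digit_of_digit hn (by rw [digit_add, hn, hi]; rfl)
      fun j h => (hk j h).symm)
  · intro h
    exact lt_of_digit_of_digit (by rw [digit_add, h, hi]; rfl) h hk

theorem add_bit_lt_iff {a i : XorNat} : a + bit i < a ↔ digit a i = true :=
  add_lt_iff_digit ((digit_bit i i).2 rfl) fun _ h => digit_bit_of_ne h.ne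

theorem add_bit_add_bit_lt_iff {a i j : XorNat} (h : j < i) :
    a + (bit i + bit j) < a ↔ digit a i = true :=
  add_lt_iff_digit (by rw [digit_add, (digit_bit i i).2 rfl, digit_bit_of_ne h.ne]; rfl)
    fun k hk => by rw [digit_add, digit_bit_of_ne hk.ne, digit_bit_of_ne (h.trans hk).ne]; rfl

/-! ### Additive maps to `ZMod 2`, prescribed on powers of two -/

/-- The sum over the nonzero binary digits of `a` of the values of `h`. -/
def digitSum (h : XorNat → ZMod 2) (a : XorNat) : ZMod 2 :=
  ∑ i ∈ Finset.Iio a, if digit a i then h i else 0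

theorem digitSum_eq_sum_Iio (h : XorNat → ZMod 2) {a n : XorNat} (hn : a ≤ n) :
    digitSum h a = ∑ i ∈ Finset.Iio n, if digit a i then h i else 0 := by
  unfold digitSum
  refine Finset.sum_subset (fun i hi => Finset.mem_Iio.2 ((Finset.mem_Iio.1 hi).trans_le hn))
    fun i _ hi => ?_
  exact if_neg fun hd => hi (Finset.mem_Iio.2 (lt_of_digit hd))

/-- The additive map to `ZMod 2` taking prescribed values at the powers of two. -/
def lift (h : XorNat → ZMod 2) : XorNat →+ ZMod 2 where
  toFun := digitSum h
  map_zero' := Finset.sum_eq_zero fun i _ => by simp [digit_zero]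
  map_add' a b := by
    have h1 : a ≤ max (max a b) (a + b) := (le_max_left _ _).trans (le_max_left _ _)
    have h2 : b ≤ max (max a b) (a + b) := (le_max_right _ _).trans (le_max_left _ _)
    rw [digitSum_eq_sum_Iio h h1, digitSum_eq_sum_Iio h h2,
      digitSum_eq_sum_Iio h (le_max_right _ _), ← Finset.sum_add_distrib]
    refine Finset.sum_congr rfl fun i _ => ?_
    rw [digit_add]
    cases digit a i <;> cases digit b i <;> simp [CharTwo.add_self_eq_zero]

theorem lift_apply (h : XorNat → ZMod 2) (a : XorNat) : lift h a = digitSum h a := rfl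

theorem lift_bit (h : XorNat → ZMod 2) (i : XorNat) : lift h (bit i) = h i := by
  rw [lift_apply]
  unfold digitSum
  rw [Finset.sum_eq_single i]
  · rw [if_pos ((digit_bit i i).2 rfl)]
  · intro j _ hj
    simp [digit_bit_of_ne hj.symm]
  · intro hi
    exact absurd (Finset.mem_Iio.2 (lt_bit i)) hi

/-- The parity of the number of nonzero binary digits. -/
def pop : XorNat →+ ZMod 2 := lift fun _ => 1

theorem pop_bit (i : XorNat) : pop (bit i) = 1 := lift_bit _ _

/-- Whether the digit of index `i` is nonzero, as an additive map. -/
def digitHom (i : XorNat) : XorNat →+ ZMod 2 := lift fun j => if j = i then 1 else 0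

theorem digitHom_apply (i a : XorNat) : digitHom i a = if digit a i then 1 else 0 := by
  change digitSum _ a = _
  unfold digitSum
  have : ∀ j, (if digit a j then (if j = i then (1 : ZMod 2) else 0) else 0) =
      if j = i then (if digit a i then 1 else 0) else 0 := fun j => by
    by_cases hj : j = i
    · subst hj; simp
    · simp [hj]
  simp_rw [this]
  rw [Finset.sum_ite_eq']
  by_cases h : digit a i = true
  · rw [if_pos (Finset.mem_Iio.2 (lt_of_digit h))]
  · simp [h]

/-- The parity of the number of edges of a rooted tree with the given code. -/
def treeSize (a : XorNat) : ZMod 2 :=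
  ∑ i ∈ (Finset.Iio a).attach, if digit a i.1 then 1 + treeSize i.1 else 0
termination_by wellFounded_lt.wrap a
decreasing_by exact Finset.mem_Iio.1 i.2

theorem treeSize_eq_lift (a : XorNat) : treeSize a = lift (fun i => 1 + treeSize i) a := by
  rw [treeSize, Finset.sum_attach (Finset.Iio a) fun i => if digit a i then 1 + treeSize i else 0]
  rfl

theorem zmod_two_cases (a : ZMod 2) : a = 0 ∨ a = 1 := by
  revert a; decide

theorem zmod_two_ne_zero {a : ZMod 2} : a ≠ 0 ↔ a = 1 := by
  revert a; decide

/-! ### Arithmetic of odd shifts -/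

/-- The differences between the codes of a rooted tree before and after the deletion of a vertex
of odd degree other than the root. -/
inductive OddShift : XorNat → Prop
  | single {e : XorNat} (h : pop e = 0) : OddShift (bit e)
  | pair {r s : XorNat} (h : OddShift (r + s)) : OddShift (bit r + bit s)

theorem OddShift.ne_zero {a : XorNat} (h : OddShift a) : a ≠ 0 := by
  induction h with
  | single _ => exact bit_ne_zero _
  | pair _ ih => exact fun h0 => ih (add_eq_zero.2 (bit_injective (add_eq_zero.1 h0)))

/-- If the sum of two binary digits `e`, `f` is an odd shift then so is `e + f`. -/
theorem OddShift.of_bit_add_bit {e f : XorNat} (hef : e ≠ f) (h : OddShift (bit e + bit f)) :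
    OddShift (e + f) := by
  generalize hx : bit e + bit f = x at h
  cases h with
  | @single z _ =>
    have := congrArg pop hx
    rw [map_add, pop_bit, pop_bit, pop_bit] at this
    exact absurd this (by decide)
  | @pair r s h =>
    have hd : ∀ i, (i = e ∨ i = f) → (i = r ∨ i = s) := by
      intro i hi
      have h1 : digit (bit e + bit f) i = true := by
        rw [digit_add]
        rcases hi with rfl | rfl
        · rw [(digit_bit i i).2 rfl, digit_bit_of_ne hef.symm]; rfl
        · rw [(digit_bit i i).2 rfl, digit_bit_of_ne hef]; rfl
      rw [hx, digit_add] at h1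
      by_contra! hc
      rw [digit_bit_of_ne hc.1.symm, digit_bit_of_ne hc.2.symm] at h1
      simp at h1
    rcases hd e (Or.inl rfl) with rfl | rfl <;> rcases hd f (Or.inr rfl) with rfl | rfl
    · exact absurd rfl hef
    · exact h
    · rwa [add_comm]
    · exact absurd rfl hef

theorem OddShift.cases {a : XorNat} (h : OddShift a) :
    (∃ e, a = bit e ∧ pop e = 0) ∨ ∃ r s, a = bit r + bit s ∧ r ≠ s := by
  have h0 := h.ne_zero
  cases h with
  | @single e he => exact Or.inl ⟨e, rfl, he⟩
  | @pair r s h => exact Or.inr ⟨r, s, rfl, fun hrs => h0 (by rw [hrs, add_self])⟩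

/-- Descend through children until a leaf appears as digit `0`; removing that leaf lowers every code
on the way back up. -/
theorem exists_lt_oddShift {a : XorNat} : a ≠ 0 → ∃ b, b < a ∧ OddShift (a + b) := by
  induction a using WellFoundedLT.induction with
  | _ a ih =>
    intro h
    obtain ⟨i, hi⟩ := exists_digit h
    by_cases h0 : i = 0
    · subst h0
      refine ⟨a + bit 0, add_bit_lt_iff.2 hi, ?_⟩
      rw [add_add_cancel_left]
      exact .single (map_zero _)
    · obtain ⟨j, hj, hs⟩ := ih i (lt_of_digit hi) h0
      refine ⟨a + (bit i + bit j), (add_bit_add_bit_lt_iff hj).2 hi, ?_⟩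
      rw [add_add_cancel_left]
      exact .pair hs

/-- The tree has an even, positive number of branches. One odd shift must leave it nontrivial and
out of reach of a second odd shift to zero. The obvious candidates fail only if there are just two
branches, with digit counts of equal parity; the induction then passes to the nim sum of the two
branch codes. -/
theorem exists_lt_not_oddShift {c : XorNat} :
    c ≠ 0 → pop c = 0 → ∃ q, q < c ∧ q ≠ 0 ∧ OddShift (c + q) ∧ ¬ OddShift q := by
  induction c using WellFoundedLT.induction with
  | _ c ih =>
    intro hc hp
    have key : ∀ e f, c = bit e + bit f → pop e = pop f →
        ∃ q, q < c ∧ q ≠ 0 ∧ OddShift (c + q) ∧ ¬ OddShift q := by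
      intro e f hef hpop
      have hne : e ≠ f := fun h => hc (by rw [hef, h, add_self])
      have hde : digit c e = true := by
        rw [hef, digit_add, (digit_bit e e).2 rfl, digit_bit_of_ne hne.symm]; rfl
      have hdf : digit c f = true := by
        rw [hef, digit_add, (digit_bit f f).2 rfl, digit_bit_of_ne hne]; rfl
      have hlt : e + f < c := by
        -- All digits of `e` and `f` have index below `f`, so `e + f < 2 ^ f ≤ c`.
        have h1 : ∀ e f, e < f → digit c f = true → e + f < c := fun e f h hd => by
          by_contra! hle
          have h2 : ∀ i, f < i → digit (bit f) i = false := fun i hi => digit_bit_of_ne hi.ne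
          have h3 : ∀ i, f ≤ i → digit (e + f) i = false := fun i hi => by
            rw [digit_add]
            have h4 : digit e i = false := by
              by_contra hd; exact (lt_of_digit (by simpa using hd)).not_ge (h.le.trans hi)
            have h5 : digit f i = false := by
              by_contra hd; exact (lt_of_digit (by simpa using hd)).not_ge hi
            rw [h4, h5]; rfl
          have h6 : e + f < bit f := lt_of_digit_of_digit (h3 f le_rfl) ((digit_bit f f).2 rfl)
            fun j hj => by rw [h3 j hj.le, h2 j hj]
          have h7 : bit f ≤ c := Nat.ge_two_pow_of_testBit hd
          exact (h6.trans_le h7).not_ge hle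
        rcases lt_or_gt_of_ne hne with h | h
        · exact h1 e f h hdf
        · rw [add_comm]; exact h1 f e h hde
      obtain ⟨q, hq, hq0, hs, hn⟩ := ih (e + f) hlt (fun h => hne (add_eq_zero.1 h))
        (by rw [map_add, hpop]; exact CharTwo.add_self_eq_zero _)
      -- The branch `e` is replaced by `q + f`, so the two branches now have nim sum `q`. By
      -- `OddShift.of_bit_add_bit`, an odd shift here would make `q` one.
      have main : ∀ e f, c = bit e + bit f → e ≠ f → OddShift (e + f + q) → q + f < e →
          ∃ q, q < c ∧ q ≠ 0 ∧ OddShift (c + q) ∧ ¬ OddShift q := by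
        intro e f hef hne hs hlt
        have hde : digit c e = true := by
          rw [hef, digit_add, (digit_bit e e).2 rfl, digit_bit_of_ne hne.symm]; rfl
        have hcq : c + (bit e + bit (q + f)) = bit (q + f) + bit f := by
          rw [hef, add_comm (bit e) (bit f), add_assoc, add_add_cancel_left, add_comm]
        have hqf : q + f ≠ f := fun h => hq0 (by simpa using h)
        refine ⟨bit (q + f) + bit f, ?_, ?_, ?_, ?_⟩
        · rw [← hcq]; exact (add_bit_add_bit_lt_iff hlt).2 hde
        · exact fun h => hqf (bit_injective (add_eq_zero.1 h))
        · rw [← hcq, add_add_cancel_left]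
          refine .pair ?_
          rwa [add_comm q f, ← add_assoc]
        · intro h
          have := h.of_bit_add_bit hqf
          rw [add_add_cancel_right] at this
          exact hn this
      rcases lt_add_cases hq with h | h
      · exact main e f hef hne hs h
      · exact main f e (by rw [hef, add_comm]) hne.symm (by rwa [add_comm f e]) h
    -- A branch whose root has an even number of children is removed. The remaining number of digits
    -- is odd, so the result is nonzero, and it can be an odd shift only as a single power of two.
    by_cases hev : ∃ e, digit c e = true ∧ pop e = 0
    · obtain ⟨e, he, hpe⟩ := hev
      have hpq : pop (c + bit e) = 1 := by rw [map_add, hp, pop_bit]; rfl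
      by_cases hE : OddShift (c + bit e)
      · rcases hE.cases with ⟨f, hf, hpf⟩ | ⟨r, s, hrs, _⟩
        · refine key f e ?_ (by rw [hpf, hpe])
          rw [← hf, add_add_cancel_right]
        · rw [hrs, map_add, pop_bit, pop_bit] at hpq
          exact absurd hpq (by decide)
      · refine ⟨c + bit e, add_bit_lt_iff.2 he, ?_, ?_, hE⟩
        · intro h0
          rw [h0, map_zero] at hpq
          exact absurd hpq (by decide)
        · rw [add_add_cancel_left]; exact .single hpe
    · push Not at hev
      obtain ⟨i, hi⟩ := exists_digit hc
      -- Minimality of `r` ensures that the smaller `s` replacing it is a new digit, so that it does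
      -- not cancel.
      obtain ⟨r, hr, hmin⟩ := wellFounded_lt.has_min {i | digit c i = true} ⟨i, hi⟩
      have hr0 : r ≠ 0 := fun h => hev r hr (by rw [h, map_zero])
      obtain ⟨s, hsr, hs⟩ := exists_lt_oddShift hr0
      have hsc : digit c s = false := by
        by_contra hd
        exact hmin s (by simpa using hd) hsr
      set q := c + (bit r + bit s) with hqdef
      have hdq : digit q s = true := by
        rw [hqdef, digit_add, digit_add, hsc, digit_bit_of_ne hsr.ne', (digit_bit s s).2 rfl]; rfl
      have hcq : c + q = bit r + bit s := by rw [hqdef, add_add_cancel_left]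
      by_cases hE : OddShift q
      · have hpq : pop q = 0 := by
          rw [hqdef, map_add, map_add, hp, pop_bit, pop_bit]; decide
        -- The number of digits of `q` is even, so an odd shift has exactly two digits here, one of
        -- which is `s`.
        have hb : ∃ b, q = bit s + bit b := by
          rcases hE.cases with ⟨f, hf, hpf⟩ | ⟨a, b, hab, _⟩
          · rw [hf, pop_bit] at hpq
            exact absurd hpq (by decide)
          · rw [hab, digit_add] at hdq
            by_cases has : a = s
            · exact ⟨b, by rw [hab, has]⟩
            · rw [digit_bit_of_ne has, Bool.false_xor, digit_bit] at hdq
              exact ⟨a, by rw [hab, hdq, add_comm]⟩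
        obtain ⟨b, hb⟩ := hb
        have hcb : c = bit r + bit b := by
          have : c = bit r + bit s + q := by rw [← hcq, add_add_cancel_right]
          rw [this, hb, add_assoc, add_add_cancel_left]
        have hrb : r ≠ b := fun h => hc (by rw [hcb, h, add_self])
        refine key r b hcb ?_
        rw [zmod_two_ne_zero.1 (hev r hr), zmod_two_ne_zero.1 (hev b ?_)]
        rw [hcb, digit_add, (digit_bit b b).2 rfl, digit_bit_of_ne hrb]; rfl
      · exact ⟨q, (add_bit_add_bit_lt_iff hsr).2 hr, fun h => by
          rw [h, digit_zero] at hdq; simp at hdq, by rw [hcq]; exact .pair hs, hE⟩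

end XorNat

open XorNat

/-! ### Rooted forests and their codes -/

/-- A parent function on `V`, whose fixed points are the roots, with the distance to the root. -/
structure Rooting (V : Type*) where
  par : V → V
  lev : V → ℕ
  lev_par : ∀ x, par x ≠ x → lev x = lev (par x) + 1
  lev_root : ∀ x, par x = x → lev x = 0

namespace Rooting

variable {V : Type*} [Fintype V] (R : Rooting V)

open Classical in
/-- The children of `x` that are joined to `x`, when `P` is the set of vertices that are joined to
their parents. -/
noncomputable def children (P : Set V) (x : V) : Finset V :=
  Finset.univ.filter fun y => y ∈ P ∧ R.par y = x ∧ y ≠ x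

variable {R} {P P' : Set V} {t x y z : V}

theorem mem_children : y ∈ R.children P x ↔ y ∈ P ∧ R.par y = x ∧ y ≠ x := by
  simp [children]

theorem lev_of_mem_children (h : y ∈ R.children P x) : R.lev y = R.lev x + 1 := by
  obtain ⟨_, h1, h2⟩ := mem_children.1 h
  rw [R.lev_par y (by rw [h1]; exact h2.symm), h1]

theorem lev_le_sup (x : V) : R.lev x ≤ Finset.univ.sup R.lev :=
  Finset.le_sup (Finset.mem_univ x)

variable (R) in
/-- The code of the rooted tree of descendants of `x`: the sum over the children `y` of `x` of the
powers of two with exponent the code of `y`. -/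
noncomputable def code (P : Set V) (x : V) : XorNat :=
  ∑ y ∈ (R.children P x).attach, bit (code P y.1)
termination_by Finset.univ.sup R.lev - R.lev x
decreasing_by
  have h1 := lev_of_mem_children y.2
  have h2 := R.lev_le_sup y.1
  omega

theorem code_eq (P : Set V) (x : V) : R.code P x = ∑ y ∈ R.children P x, bit (R.code P y) := by
  rw [code, Finset.sum_attach (R.children P x) fun y => bit (R.code P y)]

/-- Induction from the children to the parent. -/
theorem child_induction {Q : V → Prop} (h : ∀ x, (∀ y ∈ R.children Set.univ x, Q y) → Q x)
    (x : V) : Q x := by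
  induction hn : Finset.univ.sup R.lev - R.lev x using Nat.strong_induction_on generalizing x with
  | _ n ih =>
    refine h x fun y hy => ih _ ?_ y rfl
    have h1 := lev_of_mem_children hy
    have h2 := R.lev_le_sup y
    omega

theorem mem_children_univ (h : y ∈ R.children P x) : y ∈ R.children Set.univ x := by
  rw [mem_children] at *
  exact ⟨Set.mem_univ _, h.2⟩

theorem pop_code (P : Set V) (x : V) : pop (R.code P x) = (R.children P x).card := by
  rw [code_eq, map_sum]
  simp [pop_bit]

theorem treeSize_code (P : Set V) (x : V) :
    treeSize (R.code P x) = ∑ y ∈ R.children P x, (1 + treeSize (R.code P y)) := by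
  rw [treeSize_eq_lift, code_eq, map_sum]
  simp [lift_bit]

/-- A digit of the code of `x` is the code of some child. -/
theorem exists_child_of_digit {e : XorNat} (h : digit (R.code P x) e = true) :
    ∃ y ∈ R.children P x, R.code P y = e := by
  by_contra! hc
  have h1 : digitHom e (R.code P x) = 1 := by rw [digitHom_apply, if_pos h]
  rw [code_eq, map_sum, Finset.sum_eq_zero] at h1
  · simp at h1
  · intro y hy
    rw [digitHom_apply, digit_bit_of_ne (hc y hy)]
    simp

/-- Grouping the vertices of `P` by parent expresses the sum of all tree sizes as a sum over `P`;
the terms `treeSize` over `P` then cancel, leaving `1` for each edge to a parent. -/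
theorem card_eq_sum_treeSize (hP : ∀ y ∈ P, R.par y ≠ y) [DecidablePred (· ∈ P)] :
    ((Finset.univ.filter (· ∈ P)).card : ZMod 2) =
      ∑ x ∈ Finset.univ.filter (· ∉ P), treeSize (R.code P x) := by
  classical
  have h1 : ∑ x, treeSize (R.code P x) =
      ∑ y ∈ Finset.univ.filter (· ∈ P), (1 + treeSize (R.code P y)) := by
    rw [← Finset.sum_fiberwise (Finset.univ.filter (· ∈ P)) R.par]
    refine Finset.sum_congr rfl fun x _ => ?_
    rw [treeSize_code]
    refine Finset.sum_congr ?_ fun _ _ => rfl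
    ext y
    simp only [mem_children, Finset.mem_filter, Finset.mem_univ, true_and]
    constructor
    · exact fun h => ⟨h.1, h.2.1⟩
    · rintro ⟨h, rfl⟩
      exact ⟨h, rfl, (hP y h).symm⟩
  rw [← Finset.sum_filter_add_sum_filter_not Finset.univ (· ∈ P), Finset.sum_add_distrib] at h1
  simp only [Finset.sum_const, nsmul_eq_mul, mul_one] at h1
  have h2 : ∀ a b c : ZMod 2, a + b = c + a → c = b := by decide
  exact h2 _ _ _ h1

variable (R) in
/-- `y` can be reached from `t` by going repeatedly to a joined parent. -/
def Below (P : Set V) : V → V → Prop :=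
  Relation.ReflTransGen fun a b => a ∈ R.children P b

theorem Below.parent (h : R.Below P t y) (hy : y ∈ R.children P x) : R.Below P t x :=
  Relation.ReflTransGen.tail h hy

theorem below_of_mem_children (hy : y ∈ R.children P x) : R.Below P y x :=
  Relation.ReflTransGen.single hy

theorem Below.lev_le (h : R.Below P t x) : R.lev x ≤ R.lev t := by
  induction h with
  | refl => exact le_rfl
  | tail _ h ih => have := lev_of_mem_children h; omega

theorem Below.eq_of_lev_eq (h : R.Below P t x) (hl : R.lev t = R.lev x) : t = x := by
  cases h with
  | refl => rfl
  | tail h1 h2 =>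
    have := lev_of_mem_children h2
    have := Below.lev_le h1
    omega

theorem Below.eq_of_notMem (h : R.Below P t x) (ht : t ∉ P) : t = x := by
  induction h with
  | refl => rfl
  | tail _ h ih => exact absurd (mem_children.1 h).1 (ih ▸ ht)

/-- Parents are unique, so the ancestors of a vertex form a chain. -/
theorem Below.total (hx : R.Below P t x) (hy : R.Below P t y) :
    R.Below P x y ∨ R.Below P y x := by
  refine Relation.ReflTransGen.total_of_right_unique ?_ hx hy
  intro a b c hb hc
  rw [← (mem_children.1 hb).2.1, (mem_children.1 hc).2.1]

theorem Below.unique (hx : R.Below P t x) (hy : R.Below P t y) (hl : R.lev x = R.lev y) :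
    x = y := by
  rcases hx.total hy with h | h
  · exact h.eq_of_lev_eq hl
  · exact (h.eq_of_lev_eq hl.symm).symm

theorem Below.mem (h : R.Below P t x) (hne : t ≠ x) : t ∈ P := by
  by_contra ht
  exact hne (h.eq_of_notMem ht)

/-! ### Effect of a deletion on the codes -/

variable (R) in
/-- `P'` arises from `P` by the deletion of the vertex `t` or of the edge that joins `t` to its
parent. -/
def Deletion (P P' : Set V) (t : V) : Prop :=
  t ∉ P' ∧ ∀ y, y ≠ t → R.par y ≠ t → (y ∈ P' ↔ y ∈ P)

theorem Deletion.children_eq (h : R.Deletion P P' t) (hx : x ≠ t) (ht : t ∉ R.children P x) :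
    R.children P' x = R.children P x := by
  ext y
  by_cases hy : y = t
  · subst hy
    have : y ∉ R.children P' x := fun hc => h.1 (mem_children.1 hc).1
    simp [this, ht]
  · rw [mem_children, mem_children]
    constructor
    · rintro ⟨h1, h2, h3⟩
      exact ⟨(h.2 y hy (h2 ▸ hx)).1 h1, h2, h3⟩
    · rintro ⟨h1, h2, h3⟩
      exact ⟨(h.2 y hy (h2 ▸ hx)).2 h1, h2, h3⟩

open Classical in
theorem Deletion.children_erase (h : R.Deletion P P' t) (hx : x ≠ t) :
    R.children P' x = (R.children P x).erase t := by
  ext y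
  by_cases hy : y = t
  · subst hy
    have : y ∉ R.children P' x := fun hc => h.1 (mem_children.1 hc).1
    simp [this]
  · rw [Finset.mem_erase, mem_children, mem_children]
    constructor
    · rintro ⟨h1, h2, h3⟩
      exact ⟨hy, (h.2 y hy (h2 ▸ hx)).1 h1, h2, h3⟩
    · rintro ⟨_, h1, h2, h3⟩
      exact ⟨(h.2 y hy (h2 ▸ hx)).2 h1, h2, h3⟩

theorem Deletion.code_eq_of_not_below (h : R.Deletion P P' t) (x : V) :
    ¬ R.Below P t x → R.code P' x = R.code P x := by
  induction x using R.child_induction with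
  | h x ih =>
    intro hx
    have hxt : x ≠ t := fun h => hx (h ▸ Relation.ReflTransGen.refl)
    rw [code_eq, code_eq, h.children_eq hxt fun ht => hx (below_of_mem_children ht)]
    exact Finset.sum_congr rfl fun y hy => by
      rw [ih y (mem_children_univ hy) fun hb => hx (hb.parent hy)]

theorem Deletion.code_of_mem_children (h : R.Deletion P P' t) (ht : t ∈ R.children P x) :
    R.code P x = bit (R.code P t) + R.code P' x := by
  classical
  have hxt : x ≠ t := (mem_children.1 ht).2.2.symm
  rw [code_eq, ← Finset.add_sum_erase _ _ ht, code_eq P' x, h.children_erase hxt]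
  congr 1
  refine Finset.sum_congr rfl fun y hy => ?_
  rw [Finset.mem_erase] at hy
  rw [h.code_eq_of_not_below y fun hb => hy.1 ?_]
  refine (hb.eq_of_lev_eq ?_).symm
  rw [lev_of_mem_children ht, lev_of_mem_children hy.2]

/-- Among the children of `x` only `y` is an ancestor of `t`, so the terms of its siblings cancel.
-/
theorem Deletion.code_of_below (h : R.Deletion P P' t) (hy : y ∈ R.children P x)
    (hty : R.Below P t y) (hne : t ≠ y) :
    R.code P x + R.code P' x = bit (R.code P y) + bit (R.code P' y) := by
  classical
  have hlev : R.lev x < R.lev t := by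
    have h1 := lev_of_mem_children hy
    have h2 := hty.lev_le
    omega
  have hxt : x ≠ t := fun h => by rw [h] at hlev; exact lt_irrefl _ hlev
  have ht : t ∉ R.children P x := fun ht => hne (hty.eq_of_lev_eq
    (by rw [lev_of_mem_children ht, lev_of_mem_children hy]))
  rw [code_eq, code_eq P', h.children_eq hxt ht, ← Finset.add_sum_erase _ _ hy,
    ← Finset.add_sum_erase _ (fun y => bit (R.code P' y)) hy]
  have : ∑ z ∈ (R.children P x).erase y, bit (R.code P' z) =
      ∑ z ∈ (R.children P x).erase y, bit (R.code P z) := by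
    refine Finset.sum_congr rfl fun z hz => ?_
    rw [Finset.mem_erase] at hz
    rw [h.code_eq_of_not_below z fun hb => hz.1 ?_]
    exact hb.unique hty (by rw [lev_of_mem_children hz.2, lev_of_mem_children hy])
  rw [this, add_add_add_comm, add_self, add_zero]

/-- The deletion of a vertex of odd degree other than the root changes the code of the root by an
odd shift. -/
theorem Deletion.oddShift (h : R.Deletion P P' t) (hp : pop (R.code P t) = 0)
    (htx : R.Below P t x) : t ≠ x → OddShift (R.code P x + R.code P' x) := by
  induction htx with
  | refl => exact fun h => absurd rfl h
  | @tail y z hty hy ih =>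
    intro _
    by_cases hne : t = y
    · subst hne
      rw [h.code_of_mem_children hy, add_add_cancel_right]
      exact .single hp
    · rw [h.code_of_below hy hty hne]
      exact .pair (ih hne)

/-- Every odd shift that decreases the code of `x` results from the deletion of a vertex. -/
theorem exists_deletion {a : XorNat} (ha : OddShift a) :
    ∀ x q, q < R.code P x → R.code P x + q = a →
      ∃ t, t ≠ x ∧ R.Below P t x ∧ pop (R.code P t) = 0 ∧
        ∀ P', R.Deletion P P' t → R.code P' x = q := by
  induction ha with
  | @single e he =>
    intro x q hq hx
    have hq' := add_eq_iff.1 hx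
    rw [hq', add_bit_lt_iff] at hq
    obtain ⟨t, ht, hte⟩ := exists_child_of_digit hq
    refine ⟨t, (mem_children.1 ht).2.2, below_of_mem_children ht, by rw [hte, he], ?_⟩
    intro P' h
    rw [hq', h.code_of_mem_children ht, hte, add_right_comm, add_self, zero_add]
  | @pair r s h ih =>
    -- With `s < r` the code of `x` decreases only if `r` is one of its digits. Some child then has
    -- code `r`, and the shift from `r` to `s` is realised below that child.
    have main : ∀ r s : XorNat, s < r → (∀ x q, q < R.code P x → R.code P x + q = r + s →
        ∃ t, t ≠ x ∧ R.Below P t x ∧ pop (R.code P t) = 0 ∧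
          ∀ P', R.Deletion P P' t → R.code P' x = q) →
        ∀ x q, q < R.code P x → R.code P x + q = bit r + bit s →
          ∃ t, t ≠ x ∧ R.Below P t x ∧ pop (R.code P t) = 0 ∧
            ∀ P', R.Deletion P P' t → R.code P' x = q := by
      intro r s hsr ih x q hq hx
      have hq' := add_eq_iff.1 hx
      rw [hq', add_bit_add_bit_lt_iff hsr] at hq
      obtain ⟨y, hy, hyr⟩ := exists_child_of_digit hq
      obtain ⟨t, hty, hb, hp, hd⟩ := ih y s (by rwa [hyr]) (by rw [hyr])
      refine ⟨t, ?_, hb.parent hy, hp, ?_⟩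
      · rintro rfl
        have h1 := lev_of_mem_children hy
        have h2 := hb.lev_le
        omega
      · intro P' h
        have := h.code_of_below hy hb hty
        rw [hyr, hd P' h] at this
        rw [hq', ← this, add_add_cancel_left]
    rcases lt_trichotomy s r with hsr | hsr | hsr
    · exact main r s hsr ih
    · exact absurd (by rw [hsr, add_self]) h.ne_zero
    · intro x q hq hx
      exact main s r hsr (by rwa [add_comm s r]) x q hq (by rw [hx, add_comm])

end Rooting

/-! ### Parities of vertices, edges and degrees -/

section parity

variable {V : Type*} [Fintype V] {G : SimpleGraph V} (H : G.Subgraph)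

/-- The parity of the number of vertices. -/
noncomputable def vertParity : ZMod 2 := (H.verts.ncard : ZMod 2)

/-- The parity of the number of edges. -/
noncomputable def edgeParity : ZMod 2 := (H.edgeSet.ncard : ZMod 2)

/-- The parity of the degree of a vertex. -/
noncomputable def degParity (v : V) : ZMod 2 := ((H.neighborSet v).ncard : ZMod 2)

variable {H}

theorem natCast_zmod_two_eq_zero {n : ℕ} : (n : ZMod 2) = 0 ↔ n % 2 = 0 := by
  rw [ZMod.natCast_eq_zero_iff]
  omega

theorem natCast_zmod_two_eq_one {n : ℕ} : (n : ZMod 2) = 1 ↔ n % 2 = 1 := by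
  rw [ZMod.natCast_eq_one_iff_odd, Nat.odd_iff]

theorem parity_eq_zero_iff : parity H = 0 ↔ vertParity H = 0 ∧ edgeParity H = 0 := by
  unfold parity vertParity edgeParity
  rw [natCast_zmod_two_eq_zero, natCast_zmod_two_eq_zero]
  omega

theorem parity_eq_three_iff : parity H = 3 ↔ vertParity H = 1 ∧ edgeParity H = 1 := by
  unfold parity vertParity edgeParity
  rw [natCast_zmod_two_eq_one, natCast_zmod_two_eq_one]
  omega

theorem vertParity_deleteVerts {v : V} (hv : v ∈ H.verts) :
    vertParity (H.deleteVerts {v}) = vertParity H + 1 := by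
  unfold vertParity
  rw [SimpleGraph.Subgraph.deleteVerts_verts,
    ← Set.ncard_sdiff_singleton_add_one hv (Set.toFinite _)]
  push_cast
  have h : ∀ a : ZMod 2, a = a + 1 + 1 := by decide
  exact h _

theorem vertParity_deleteEdges (s : Set (Sym2 V)) :
    vertParity (H.deleteEdges s) = vertParity H := rfl

theorem edgeParity_deleteVerts (v : V) :
    edgeParity (H.deleteVerts {v}) = edgeParity H + degParity H v := by
  unfold edgeParity degParity
  have h1 : H.edgeSet = (H.deleteVerts {v}).edgeSet ∪ (fun w => s(v, w)) '' H.neighborSet v := by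
    ext e
    induction e with
    | _ a b =>
      simp only [Set.mem_union, SimpleGraph.Subgraph.mem_edgeSet,
        SimpleGraph.Subgraph.deleteVerts_adj, Set.mem_image, Set.mem_singleton_iff,
        SimpleGraph.Subgraph.mem_neighborSet, Sym2.eq_iff]
      constructor
      · intro h
        by_cases ha : a = v
        · exact Or.inr ⟨b, ha ▸ h, Or.inl ⟨ha.symm, rfl⟩⟩
        · by_cases hb : b = v
          · exact Or.inr ⟨a, hb ▸ h.symm, Or.inr ⟨hb.symm, rfl⟩⟩
          · exact Or.inl ⟨h.fst_mem, ha, h.snd_mem, hb, h⟩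
      · rintro (h | ⟨w, h, ⟨rfl, rfl⟩ | ⟨rfl, rfl⟩⟩)
        · exact h.2.2.2.2
        · exact h
        · exact h.symm
  have h2 : Disjoint (H.deleteVerts {v}).edgeSet ((fun w => s(v, w)) '' H.neighborSet v) := by
    rw [Set.disjoint_right]
    rintro _ ⟨w, _, rfl⟩ h
    simp at h
  have h3 : Function.Injective fun w => s(v, w) := fun a b h => Sym2.congr_right.1 h
  rw [h1, Set.ncard_union_eq h2 (Set.toFinite _) (Set.toFinite _), Set.ncard_image_of_injective _ h3]
  push_cast
  rw [add_assoc, CharTwo.add_self_eq_zero, add_zero]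

theorem edgeParity_deleteEdges {e : Sym2 V} (he : e ∈ H.edgeSet) :
    edgeParity (H.deleteEdges {e}) = edgeParity H + 1 := by
  unfold edgeParity
  have : (H.deleteEdges {e}).edgeSet = H.edgeSet \ {e} := by
    ext f
    induction f with
    | _ a b => simp
  rw [this, ← Set.ncard_sdiff_singleton_add_one he (Set.toFinite _)]
  push_cast
  have h : ∀ a : ZMod 2, a = a + 1 + 1 := by decide
  exact h _

open Classical in
theorem ncard_neighborSet_eq_degree (v : V) :
    (H.neighborSet v).ncard = H.spanningCoe.degree v := by
  rw [← SimpleGraph.card_neighborFinset_eq_degree, ← Set.ncard_coe_finset]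
  congr 1
  ext w
  simp

open Classical in
theorem ncard_edgeSet_eq_card : H.edgeSet.ncard = H.spanningCoe.edgeFinset.card := by
  rw [← Set.ncard_coe_finset]
  congr 1
  ext e
  induction e with
  | _ a b => simp

/-- If all degrees were odd, their even sum would force an even number of vertices. -/
theorem exists_degParity_eq_zero (h : vertParity H = 1) : ∃ v ∈ H.verts, degParity H v = 0 := by
  classical
  by_contra! hc
  have h1 := H.spanningCoe.sum_degrees_eq_twice_card_edges
  have h2 : ∑ v, degParity H v = 0 := by
    unfold degParity
    simp_rw [ncard_neighborSet_eq_degree]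
    rw [← Nat.cast_sum, h1]
    push_cast
    rw [show (2 : ZMod 2) = 0 from rfl, zero_mul]
  have h3 : ∀ v, degParity H v = if v ∈ H.verts then 1 else 0 := by
    intro v
    split_ifs with hv
    · exact zmod_two_ne_zero.1 (hc v hv)
    · unfold degParity
      have : H.neighborSet v = ∅ := by
        ext w
        simp only [SimpleGraph.Subgraph.mem_neighborSet, Set.mem_empty_iff_false, iff_false]
        exact fun h => hv h.fst_mem
      rw [this]
      simp
  simp_rw [h3] at h2
  rw [Finset.sum_boole] at h2
  unfold vertParity at h
  rw [Set.ncard_eq_toFinset_card'] at h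
  have : H.verts.toFinset = Finset.univ.filter (· ∈ H.verts) := by
    ext v; simp
  rw [this, h2] at h
  exact absurd h (by decide)

theorem mem_verts_of_degParity {v : V} (h : degParity H v = 1) : v ∈ H.verts := by
  by_contra hv
  have : H.neighborSet v = ∅ := by
    ext w
    simp only [SimpleGraph.Subgraph.mem_neighborSet, Set.mem_empty_iff_false, iff_false]
    exact fun h => hv h.fst_mem
  unfold degParity at h
  rw [this] at h
  simp at h

/-- A forest is bipartite, and the degrees on one side add up to the number of edges. -/
theorem exists_degParity_eq_one (hH : H.spanningCoe.IsAcyclic) (h : edgeParity H = 1) :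
    ∃ v ∈ H.verts, degParity H v = 1 := by
  classical
  obtain ⟨s, t, hst⟩ := hH.isBipartite.exists_isBipartiteWith
  have h1 : H.spanningCoe.IsBipartiteWith (s.toFinset : Set V) (t.toFinset : Set V) := by
    simpa using hst
  have h2 := SimpleGraph.isBipartiteWith_sum_degrees_eq_card_edges h1
  by_contra! hc
  unfold edgeParity at h
  rw [ncard_edgeSet_eq_card, ← h2] at h
  push_cast at h
  rw [Finset.sum_eq_zero] at h
  · exact absurd h (by decide)
  · intro v _
    rw [← ncard_neighborSet_eq_degree]
    by_contra hv
    have := zmod_two_ne_zero.1 hv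
    exact hc v (mem_verts_of_degParity this) this

end parity

/-! ### Kernels and nim-value zero -/

section mex

theorem mex_eq_zero_iff {S : Set ℕ} (hS : S.Finite) : mex S = 0 ↔ 0 ∉ S := by
  unfold mex
  rw [Nat.sInf_eq_zero]
  have : Sᶜ ≠ ∅ := hS.infinite_compl.nonempty.ne_empty
  simp only [this, or_false, Set.mem_compl_iff]

theorem nimValue_eq_zero_iff {V : Type*} [Finite V] {G : SimpleGraph V} (H : G.Subgraph) :
    nimValue H = 0 ↔ ∀ K, IsMove H K → nimValue K ≠ 0 := by
  rw [nimValue, mex_eq_zero_iff (Set.finite_range _)]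
  simp

/-- A set of positions that is the set of positions of nim-value zero. -/
theorem nimValue_eq_zero_iff_of_kernel {V : Type*} [Finite V] {G : SimpleGraph V}
    (Z : G.Subgraph → Prop) (h1 : ∀ H K, IsMove H K → Z H → ¬ Z K)
    (h2 : ∀ H, ¬ Z H → ∃ K, IsMove H K ∧ Z K) (H : G.Subgraph) : nimValue H = 0 ↔ Z H := by
  induction H using WellFoundedLT.induction with
  | ind H ih =>
    rw [nimValue_eq_zero_iff]
    constructor
    · intro h
      by_contra hH
      obtain ⟨K, hK, hZ⟩ := h2 H hH
      exact h K hK ((ih K hK.lt).2 hZ)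
    · intro h K hK h0
      exact h1 H K hK h ((ih K hK.lt).1 h0)

end mex

/-! ### Unicyclic graphs and the codes of their positions -/

/-- The structure of a graph `G` with a unique cycle `C`, of odd length: outside of `C`, the graph
is a rooted forest, and the vertices of `C` are roots. -/
structure Unicyclic {V : Type*} {G : SimpleGraph V} (C : G.Subgraph) extends Rooting V where
  adj_iff : ∀ x y, G.Adj x y ↔ C.Adj x y ∨ (x ≠ y ∧ (par x = y ∨ par y = x))
  par_cycle : ∀ x ∈ C.verts, par x = x
  ncard_neighborSet : ∀ x ∈ C.verts, (C.neighborSet x).ncard = 2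
  odd_edges : Odd C.edgeSet.ncard
  acyclic : ∀ H : G.Subgraph, ¬ C ≤ H → H.spanningCoe.IsAcyclic
  -- Two-edge-connectedness of the cycle: a set left by at most one cycle edge contains all of the
  -- cycle or none of it.
  cut : ∀ (S : Set V) (a b : V), (∀ x ∈ S, ∀ y ∉ S, C.Adj x y → x = a ∧ y = b) →
    C.verts ⊆ S ∨ Disjoint C.verts S

namespace Unicyclic

variable {V : Type*} [Fintype V] {G : SimpleGraph V} {C : G.Subgraph} (R : Unicyclic C)

/-- The vertices that are joined to their parents in the position `H`. -/
def branch (H : G.Subgraph) : Set V := {y | H.Adj y (R.par y)}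

/-- The code of the tree attached to `x` in the position `H`. -/
noncomputable def treeCode (H : G.Subgraph) (x : V) : XorNat := R.code (R.branch H) x

variable {R} {H K : G.Subgraph} {x y t A B : V}

theorem par_ne_of_mem_branch (h : y ∈ R.branch H) : R.par y ≠ y := fun hy => by
  have : H.Adj y (R.par y) := h
  rw [hy] at this
  exact H.loopless.irrefl _ this

theorem mem_children_branch : y ∈ R.children (R.branch H) x ↔ R.par y = x ∧ H.Adj y x := by
  rw [Rooting.mem_children]
  constructor
  · rintro ⟨h, rfl, _⟩
    exact ⟨rfl, h⟩
  · rintro ⟨rfl, h⟩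
    exact ⟨h, rfl, h.ne⟩

theorem notMem_branch_of_mem_cycle (hA : A ∈ C.verts) : A ∉ R.branch H := fun h =>
  par_ne_of_mem_branch h (R.par_cycle A hA)

theorem notMem_cycle_of_mem_branch (h : y ∈ R.branch H) : y ∉ C.verts := fun hy =>
  notMem_branch_of_mem_cycle hy h

theorem adj_cases (h : H.Adj x y) :
    C.Adj x y ∨ x ∈ R.children (R.branch H) y ∨ y ∈ R.children (R.branch H) x := by
  rcases (R.adj_iff x y).1 h.adj_sub with h1 | ⟨_, h1 | h1⟩
  · exact Or.inl h1
  · exact Or.inr (Or.inl (mem_children_branch.2 ⟨h1, h⟩))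
  · exact Or.inr (Or.inr (mem_children_branch.2 ⟨h1, h.symm⟩))

theorem degParity_of_mem_branch (h : t ∈ R.branch H) :
    degParity H t = 1 + pop (R.treeCode H t) := by
  classical
  unfold degParity treeCode
  rw [Rooting.pop_code]
  have h1 : H.neighborSet t = ↑(insert (R.par t) (R.children (R.branch H) t)) := by
    ext y
    simp only [SimpleGraph.Subgraph.mem_neighborSet, Finset.coe_insert, Set.mem_insert_iff,
      Finset.mem_coe]
    constructor
    · intro hy
      rcases adj_cases (R := R) hy with hc | hc | hc
      · exact absurd hc.fst_mem (notMem_cycle_of_mem_branch h)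
      · exact Or.inl (mem_children_branch.1 hc).1.symm
      · exact Or.inr hc
    · rintro (rfl | hy)
      · exact h
      · exact (mem_children_branch.1 hy).2.symm
  have h2 : R.par t ∉ R.children (R.branch H) t := fun hc => by
    have h3 := Rooting.lev_of_mem_children hc
    have h4 := R.lev_par t (par_ne_of_mem_branch h)
    omega
  rw [h1, Set.ncard_coe_finset, Finset.card_insert_of_notMem h2]
  push_cast
  rw [add_comm]

theorem ncard_neighborSet_of_mem_cycle (hC : C ≤ H) (hA : A ∈ C.verts) :
    (H.neighborSet A).ncard = 2 + (R.children (R.branch H) A).card := by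
  have h1 : H.neighborSet A = C.neighborSet A ∪ ↑(R.children (R.branch H) A) := by
    ext y
    simp only [SimpleGraph.Subgraph.mem_neighborSet, Set.mem_union, Finset.mem_coe]
    constructor
    · intro hy
      rcases adj_cases (R := R) hy with hc | hc | hc
      · exact Or.inl hc
      · exact absurd (Rooting.mem_children.1 hc).1 (notMem_branch_of_mem_cycle hA)
      · exact Or.inr hc
    · rintro (hy | hy)
      · exact hC.2 hy
      · exact (mem_children_branch.1 hy).2.symm
  have h2 : Disjoint (C.neighborSet A) ↑(R.children (R.branch H) A) := by
    rw [Set.disjoint_left]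
    intro y hy hc
    exact notMem_branch_of_mem_cycle (SimpleGraph.Subgraph.Adj.snd_mem hy)
      (Rooting.mem_children.1 hc).1
  rw [h1, Set.ncard_union_eq h2 (Set.toFinite _) (Set.toFinite _), R.ncard_neighborSet A hA,
    Set.ncard_coe_finset]

theorem degParity_of_mem_cycle (hC : C ≤ H) (hA : A ∈ C.verts) :
    degParity H A = pop (R.treeCode H A) := by
  unfold degParity treeCode
  rw [Rooting.pop_code, ncard_neighborSet_of_mem_cycle hC hA]
  push_cast
  rw [show (2 : ZMod 2) = 0 from rfl, zero_add]

open Classical in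
-- The cycle contributes an odd number of edges, and every other edge is counted by its endpoint
-- further from the root.
theorem edgeParity_eq (R : Unicyclic C) (hC : C ≤ H) :
    edgeParity H = 1 + ((Finset.univ.filter (· ∈ R.branch H)).card : ZMod 2) := by
  unfold edgeParity
  have h1 : H.edgeSet = C.edgeSet ∪ (fun y => s(y, R.par y)) '' R.branch H := by
    ext e
    induction e with
    | _ a b =>
      simp only [Set.mem_union, SimpleGraph.Subgraph.mem_edgeSet, Set.mem_image, Sym2.eq_iff]
      constructor
      · intro h
        rcases adj_cases (R := R) h with hc | hc | hc
        · exact Or.inl hc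
        · obtain ⟨rfl, h⟩ := mem_children_branch.1 hc
          exact Or.inr ⟨a, h, Or.inl ⟨rfl, rfl⟩⟩
        · obtain ⟨rfl, h⟩ := mem_children_branch.1 hc
          exact Or.inr ⟨b, h, Or.inr ⟨rfl, rfl⟩⟩
      · rintro (h | ⟨y, h, ⟨rfl, rfl⟩ | ⟨rfl, rfl⟩⟩)
        · exact hC.2 h
        · exact h
        · exact SimpleGraph.Subgraph.Adj.symm h
  have h2 : Disjoint C.edgeSet ((fun y => s(y, R.par y)) '' R.branch H) := by
    rw [Set.disjoint_right]
    rintro _ ⟨w, hw, rfl⟩ h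
    rw [SimpleGraph.Subgraph.mem_edgeSet] at h
    exact notMem_branch_of_mem_cycle h.fst_mem hw
  have h3 : Set.InjOn (fun y => s(y, R.par y)) (R.branch H) := by
    intro a ha b hb h
    rcases Sym2.eq_iff.1 h with h | h
    · exact h.1
    · have h4 := R.lev_par a (par_ne_of_mem_branch ha)
      have h5 := R.lev_par b (par_ne_of_mem_branch hb)
      rw [h.2] at h4
      rw [← h.1] at h5
      omega
  have h4 : R.branch H = ↑(Finset.univ.filter (· ∈ R.branch H)) := by ext; simp
  rw [h1, Set.ncard_union_eq h2 (Set.toFinite _) (Set.toFinite _), h3.ncard_image]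
  rw [Nat.cast_add]
  congr 1
  · exact natCast_zmod_two_eq_one.2 (Nat.odd_iff.1 R.odd_edges)
  · rw [← Set.ncard_coe_finset, ← h4]

theorem deletion_deleteVerts (t : V) :
    R.Deletion (R.branch H) (R.branch (H.deleteVerts {t})) t := by
  refine ⟨fun h => ?_, fun y hy hp => ?_⟩
  · have : (H.deleteVerts {t}).Adj t (R.par t) := h
    simp at this
  · change (H.deleteVerts {t}).Adj y (R.par y) ↔ H.Adj y (R.par y)
    simp only [SimpleGraph.Subgraph.deleteVerts_adj, Set.mem_singleton_iff]
    exact ⟨fun h => h.2.2.2.2, fun h => ⟨h.fst_mem, hy, h.snd_mem, hp, h⟩⟩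

theorem branch_notMem_cycle (h : R.Below (R.branch H) t x) (hne : t ≠ x) : t ∉ C.verts :=
  notMem_cycle_of_mem_branch (h.mem hne)

theorem lev_of_mem_cycle (hA : A ∈ C.verts) : R.lev A = 0 := R.lev_root A (R.par_cycle A hA)

theorem eq_of_below_of_below (hA : A ∈ C.verts) (hB : B ∈ C.verts)
    (h1 : R.Below (R.branch H) t A) (h2 : R.Below (R.branch H) t B) : A = B :=
  h1.unique h2 (by rw [lev_of_mem_cycle hA, lev_of_mem_cycle hB])

theorem le_deleteVerts (hC : C ≤ H) (ht : t ∉ C.verts) : C ≤ H.deleteVerts {t} := by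
  constructor
  · intro v hv
    rw [SimpleGraph.Subgraph.deleteVerts_verts]
    exact ⟨hC.1 hv, fun h => ht (h ▸ hv)⟩
  · intro v w h
    rw [SimpleGraph.Subgraph.deleteVerts_adj]
    exact ⟨hC.1 h.fst_mem, fun h1 => ht (h1 ▸ h.fst_mem), hC.1 h.snd_mem,
      fun h1 => ht (h1 ▸ h.snd_mem), hC.2 h⟩

theorem not_le_deleteVerts (ht : t ∈ C.verts) : ¬ C ≤ H.deleteVerts {t} := fun h => by
  have := h.1 ht
  simp at this

end Unicyclic

/-! ### The kernel of the game -/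

namespace Unicyclic

variable {V : Type*} [Fintype V] {G : SimpleGraph V} {C : G.Subgraph} (R : Unicyclic C)

/-- Some vertex of the cycle carries a nontrivial tree, and if that tree can be reduced to a point
by the deletion of a vertex of odd degree, then there is another such vertex. -/
def Sturdy (H : G.Subgraph) : Prop :=
  ∃ A ∈ C.verts, R.treeCode H A ≠ 0 ∧
    (OddShift (R.treeCode H A) → ∃ B ∈ C.verts, B ≠ A ∧ R.treeCode H B ≠ 0)

/-- The positions of nim-value zero. -/
def ZeroPosition (H : G.Subgraph) : Prop :=
  (vertParity H = 0 ∧ edgeParity H = 0 ∧ (C ≤ H → R.Sturdy H)) ∨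
    (vertParity H = 1 ∧ edgeParity H = 1 ∧ C ≤ H ∧ ∀ A ∈ C.verts, R.treeCode H A = 0)

variable {R} {H K : G.Subgraph} {x y t A B : V}

/-- The tree codes after the deletion of a vertex, away from the ancestors of that vertex. -/
theorem treeCode_deleteVerts_of_not_below (h : ¬ R.Below (R.branch H) t x) :
    R.treeCode (H.deleteVerts {t}) x = R.treeCode H x :=
  (deletion_deleteVerts t).code_eq_of_not_below x h

/-- The effect on the tree code of the deletion of a vertex of odd degree. -/
theorem oddShift_of_treeCode_ne (ht : t ∉ C.verts) (hd : degParity H t = 1) (hA : A ∈ C.verts)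
    (h : R.treeCode (H.deleteVerts {t}) A ≠ R.treeCode H A) :
    R.Below (R.branch H) t A ∧
      OddShift (R.treeCode H A + R.treeCode (H.deleteVerts {t}) A) := by
  have hb : R.Below (R.branch H) t A := by
    by_contra hb
    exact h (treeCode_deleteVerts_of_not_below hb)
  have htA : t ≠ A := fun h => ht (h ▸ hA)
  refine ⟨hb, (deletion_deleteVerts t).oddShift ?_ hb htA⟩
  rw [degParity_of_mem_branch (hb.mem htA)] at hd
  simpa [treeCode] using hd

theorem treeCode_eq_of_ne (hA : A ∈ C.verts) (hB : B ∈ C.verts) (hne : B ≠ A)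
    (hb : R.Below (R.branch H) t A) : R.treeCode (H.deleteVerts {t}) B = R.treeCode H B :=
  treeCode_deleteVerts_of_not_below fun h => hne (eq_of_below_of_below hB hA h hb)

/-- A smaller code that differs by an odd shift is reached by the deletion of a vertex of odd
degree. -/
theorem exists_odd_deletion {q : XorNat} (hq : q < R.treeCode H x)
    (hs : OddShift (R.treeCode H x + q)) :
    ∃ t ∈ R.branch H, t ≠ x ∧ R.Below (R.branch H) t x ∧ degParity H t = 1 ∧
      R.treeCode (H.deleteVerts {t}) x = q := by
  obtain ⟨t, htx, hb, hp, hd⟩ := R.exists_deletion hs x q hq rfl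
  have ht := hb.mem htx
  refine ⟨t, ht, htx, hb, ?_, hd _ (deletion_deleteVerts t)⟩
  rw [degParity_of_mem_branch ht]
  unfold treeCode
  rw [hp, add_zero]

/-- Deleting an edge changes only one parity. Deleting a vertex can only pass between even-even and
odd-odd, through a vertex of odd degree off the cycle. It changes at most one code on the cycle, by
an odd shift; on the odd-odd side all these codes vanish, contrary to `Sturdy` on the other side. -/
theorem not_zeroPosition_of_isMove (h : IsMove H K) (hH : R.ZeroPosition H) :
    ¬ R.ZeroPosition K := by
  intro hK
  have h10 : (1 : ZMod 2) ≠ 0 := by decide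
  have hcc : C ≤ K → C ≤ H := fun hc => hc.trans h.lt.le
  rcases h with ⟨t, ht, rfl⟩ | ⟨e, he, rfl⟩
  · have hv := vertParity_deleteVerts ht
    have he := edgeParity_deleteVerts (H := H) t
    rcases hH with ⟨hv0, he0, hs⟩ | ⟨hv0, he0, hC, hc⟩ <;>
      rcases hK with ⟨hv1, he1, hs'⟩ | ⟨hv1, he1, hC', hc'⟩
    · rw [hv0, hv1] at hv
      exact absurd hv (by decide)
    · rw [he0, he1, zero_add] at he
      have htC : t ∉ C.verts := fun h => not_le_deleteVerts h hC'
      obtain ⟨A, hA, hA0, hAs⟩ := hs (hcc hC')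
      obtain ⟨hb, ho⟩ := oddShift_of_treeCode_ne htC he.symm hA
        (by rw [hc' A hA]; exact hA0.symm)
      rw [hc' A hA, add_zero] at ho
      obtain ⟨B, hB, hne, hB0⟩ := hAs ho
      rw [← treeCode_eq_of_ne hA hB hne hb, hc' B hB] at hB0
      exact hB0 rfl
    · have hd : degParity H t = 1 := by
        rw [he0, he1] at he
        revert he
        generalize degParity H t = d
        revert d
        decide
      have htC : t ∉ C.verts := fun h => by
        rw [degParity_of_mem_cycle (R := R) hC h, hc t h, map_zero] at hd
        exact h10 hd.symm
      obtain ⟨A, hA, hA0, hAs⟩ := hs' (le_deleteVerts hC htC)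
      obtain ⟨hb, ho⟩ := oddShift_of_treeCode_ne htC hd hA (by rw [hc A hA]; exact hA0)
      rw [hc A hA, zero_add] at ho
      obtain ⟨B, hB, hne, hB0⟩ := hAs ho
      rw [treeCode_eq_of_ne hA hB hne hb, hc B hB] at hB0
      exact hB0 rfl
    · rw [hv0, hv1] at hv
      exact absurd hv (by decide)
  · have hv := vertParity_deleteEdges (H := H) {e}
    have he := edgeParity_deleteEdges he
    rcases hH with ⟨hv0, he0, hs⟩ | ⟨hv0, he0, hC, hc⟩ <;>
      rcases hK with ⟨hv1, he1, hs'⟩ | ⟨hv1, he1, hC', hc'⟩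
    · rw [he0, he1] at he
      exact absurd he (by decide)
    · rw [hv0, hv1] at hv
      exact absurd hv (by decide)
    · rw [hv0, hv1] at hv
      exact absurd hv (by decide)
    · rw [he0, he1] at he
      exact absurd he (by decide)

theorem zeroPosition_of_not_le (hK : ¬ C ≤ K) (hv : vertParity K = 0) (he : edgeParity K = 0) :
    R.ZeroPosition K := Or.inl ⟨hv, he, fun h => absurd h hK⟩

theorem one_add_one_zmod_two : (1 : ZMod 2) + 1 = 0 := rfl

/-- The move that deletes a vertex of a prescribed degree from a position with an odd number of
vertices, when the result does not contain the cycle. -/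
theorem exists_zeroPosition_of_vertex (hv : vertParity H = 1) (ht : t ∈ H.verts)
    (hd : degParity H t = edgeParity H) (hK : C ≤ H.deleteVerts {t} → R.Sturdy (H.deleteVerts {t})) :
    ∃ K, IsMove H K ∧ R.ZeroPosition K := by
  refine ⟨_, Or.inl ⟨t, ht, rfl⟩, Or.inl ⟨?_, ?_, hK⟩⟩
  · rw [vertParity_deleteVerts ht, hv, one_add_one_zmod_two]
  · rw [edgeParity_deleteVerts, hd]
    exact CharTwo.add_self_eq_zero _

/-- Such a position is a forest and stays one, so only the parities have to be corrected. -/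
theorem exists_zeroPosition_of_not_le (hC : ¬ C ≤ H) (h : ¬ R.ZeroPosition H) :
    ∃ K, IsMove H K ∧ R.ZeroPosition K := by
  have hK : ∀ K, K ≤ H → ¬ C ≤ K := fun K hK h => hC (h.trans hK)
  rcases zmod_two_cases (vertParity H) with hv | hv
  · rcases zmod_two_cases (edgeParity H) with he | he
    · exact absurd (zeroPosition_of_not_le hC hv he) h
    · have hne : H.edgeSet.Nonempty := by
        rw [Set.nonempty_iff_ne_empty]
        intro h0
        unfold edgeParity at he
        rw [h0] at he
        simp at he
      obtain ⟨e, heH⟩ := hne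
      refine ⟨_, Or.inr ⟨e, heH, rfl⟩, zeroPosition_of_not_le
        (hK _ (SimpleGraph.Subgraph.deleteEdges_le _)) hv ?_⟩
      rw [edgeParity_deleteEdges heH, he, one_add_one_zmod_two]
  · have hex : ∃ t ∈ H.verts, degParity H t = edgeParity H := by
      rcases zmod_two_cases (edgeParity H) with he | he
      · rw [he]; exact exists_degParity_eq_zero hv
      · rw [he]; exact exists_degParity_eq_one (R.acyclic H hC) he
    obtain ⟨t, ht, hd⟩ := hex
    exact exists_zeroPosition_of_vertex hv ht hd fun h =>
      absurd h (hK _ SimpleGraph.Subgraph.deleteVerts_le)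

theorem two_lt_card_cycle (R : Unicyclic C) : 2 < C.verts.ncard := by
  have hne : C.edgeSet.Nonempty := by
    rw [← Set.ncard_pos]
    exact R.odd_edges.pos
  obtain ⟨e, he⟩ := hne
  induction e with
  | _ a b =>
    rw [SimpleGraph.Subgraph.mem_edgeSet] at he
    have h1 : insert a (C.neighborSet a) ⊆ C.verts := by
      rintro x (rfl | hx)
      · exact he.fst_mem
      · exact SimpleGraph.Subgraph.Adj.snd_mem hx
    have h2 := Set.ncard_le_ncard h1 (Set.toFinite _)
    rw [Set.ncard_insert_of_notMem _ (Set.toFinite _), R.ncard_neighborSet a he.fst_mem] at h2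
    · omega
    · exact fun h => C.loopless.irrefl a h

theorem edge_not_le {e : Sym2 V} (he : e ∈ C.edgeSet) : ¬ C ≤ H.deleteEdges {e} := fun h => by
  induction e with
  | _ a b =>
    have := h.2 he
    simp at this

theorem exists_zeroPosition_of_le (hC : C ≤ H) (h : ¬ R.ZeroPosition H) :
    ∃ K, IsMove H K ∧ R.ZeroPosition K := by
  classical
  rcases zmod_two_cases (vertParity H) with hv | hv
  · rcases zmod_two_cases (edgeParity H) with he | he
    · have hns : ¬ R.Sturdy H := fun hs => h (Or.inl ⟨hv, he, fun _ => hs⟩)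
      -- It suffices to delete a vertex of odd degree such that the trees reduce to points.
      suffices hex : ∃ t ∈ R.branch H, degParity H t = 1 ∧
          ∀ A ∈ C.verts, R.treeCode (H.deleteVerts {t}) A = 0 by
        obtain ⟨t, ht, hd, hc⟩ := hex
        have htH := mem_verts_of_degParity hd
        refine ⟨_, Or.inl ⟨t, htH, rfl⟩, Or.inr ⟨?_, ?_,
          le_deleteVerts hC (notMem_cycle_of_mem_branch ht), hc⟩⟩
        · rw [vertParity_deleteVerts htH, hv, zero_add]
        · rw [edgeParity_deleteVerts, hd, he, zero_add]
      by_cases hall : ∀ A ∈ C.verts, R.treeCode H A = 0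
      -- The cycle has oddly many edges and the total is even, so the rest has odd size. As the
      -- trees on the cycle have code zero, some tree rooted off the cycle has nonzero code, and an
      -- odd-degree vertex can be deleted there without affecting the cycle.
      · have h1 := R.edgeParity_eq hC
        rw [he, R.card_eq_sum_treeSize fun y hy => par_ne_of_mem_branch hy] at h1
        have h2 : ∑ x ∈ Finset.univ.filter (· ∉ R.branch H), treeSize (R.treeCode H x) ≠ 0 := by
          intro h0
          change _ = 1 + ∑ x ∈ Finset.univ.filter (· ∉ R.branch H), treeSize (R.treeCode H x) at h1
          rw [h0] at h1
          exact absurd h1 (by decide)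
        obtain ⟨x, hx, hxs⟩ := Finset.exists_ne_zero_of_sum_ne_zero h2
        have hxb : x ∉ R.branch H := by simpa using hx
        have hx0 : R.treeCode H x ≠ 0 := fun h0 => hxs (by
          rw [h0, treeSize_eq_lift, map_zero])
        have hxC : x ∉ C.verts := fun hxC => hx0 (hall x hxC)
        obtain ⟨b, hb, hs⟩ := exists_lt_oddShift hx0
        obtain ⟨t, ht, -, hbel, hd, -⟩ := exists_odd_deletion hb hs
        refine ⟨t, ht, hd, fun A hA => ?_⟩
        rw [treeCode_deleteVerts_of_not_below, hall A hA]
        intro hA'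
        rcases hbel.total hA' with h | h
        · exact hxC (h.eq_of_notMem hxb ▸ hA)
        · exact hxC (h.eq_of_notMem (notMem_branch_of_mem_cycle hA) ▸ hA)
      · push Not at hall
        obtain ⟨A, hA, hA0⟩ := hall
        have hns' : OddShift (R.treeCode H A) ∧ ∀ B ∈ C.verts, B ≠ A → R.treeCode H B = 0 := by
          by_contra hc
          refine hns ⟨A, hA, hA0, fun ho => ?_⟩
          by_contra! hB
          exact hc ⟨ho, hB⟩
        obtain ⟨t, ht, -, hbel, hd, hc⟩ := exists_odd_deletion (q := 0) (pos_iff.2 hA0)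
          (by rw [add_zero]; exact hns'.1)
        refine ⟨t, ht, hd, fun B hB => ?_⟩
        by_cases hBA : B = A
        · rw [hBA, hc]
        · rw [treeCode_eq_of_ne hA hB hBA hbel, hns'.2 B hB hBA]
    -- Deleting an edge of the cycle makes the edge number even and leaves a forest.
    · have hne : C.edgeSet.Nonempty := by
        rw [← Set.ncard_pos]
        exact R.odd_edges.pos
      obtain ⟨e, heC⟩ := hne
      have heH := SimpleGraph.Subgraph.edgeSet_mono hC heC
      refine ⟨_, Or.inr ⟨e, heH, rfl⟩, zeroPosition_of_not_le (edge_not_le heC) hv ?_⟩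
      rw [edgeParity_deleteEdges heH, he, one_add_one_zmod_two]
  · by_cases hcyc : ∃ A ∈ C.verts, pop (R.treeCode H A) = edgeParity H
    · obtain ⟨A, hA, hp⟩ := hcyc
      exact exists_zeroPosition_of_vertex hv (hC.1 hA)
        (by rw [degParity_of_mem_cycle (R := R) hC hA, hp]) fun h =>
          absurd h (not_le_deleteVerts hA)
    · push Not at hcyc
      rcases zmod_two_cases (edgeParity H) with he | he
      -- All codes on the cycle have an odd digit count, hence are nonzero. A deletion affects at
      -- most one of at least three trees, so two nontrivial ones survive.
      · obtain ⟨t, ht, hd⟩ := exists_degParity_eq_zero hv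
        refine exists_zeroPosition_of_vertex hv ht (by rw [hd, he]) fun _ => ?_
        obtain ⟨a, b, c, ha, hb, hc, hab, hac, hbc⟩ :=
          (Set.two_lt_ncard_iff (Set.toFinite _)).1 R.two_lt_card_cycle
        have h0 : ∀ A ∈ C.verts, R.treeCode H A ≠ 0 := fun A hA h0 =>
          hcyc A hA (by rw [h0, map_zero, he])
        have main : ∀ A B, A ∈ C.verts → B ∈ C.verts → A ≠ B →
            ¬ R.Below (R.branch H) t A → ¬ R.Below (R.branch H) t B →
            R.Sturdy (H.deleteVerts {t}) := fun A B hA hB hne h1 h2 =>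
          ⟨A, hA, by rw [treeCode_deleteVerts_of_not_below h1]; exact h0 A hA, fun _ =>
            ⟨B, hB, hne.symm, by rw [treeCode_deleteVerts_of_not_below h2]; exact h0 B hB⟩⟩
        by_cases h1 : R.Below (R.branch H) t a
        · exact main b c hb hc hbc (fun h => hab (eq_of_below_of_below ha hb h1 h))
            (fun h => hac (eq_of_below_of_below ha hc h1 h))
        · by_cases h2 : R.Below (R.branch H) t b
          · exact main a c ha hc hac h1 (fun h => hbc (eq_of_below_of_below hb hc h2 h))
          · exact main a b ha hb hab h1 h2
      · have hex : ∃ A ∈ C.verts, R.treeCode H A ≠ 0 := by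
          by_contra! hall
          exact h (Or.inr ⟨hv, he, hC, hall⟩)
        obtain ⟨A, hA, hA0⟩ := hex
        have hp : pop (R.treeCode H A) = 0 := by
          by_contra hp
          exact hcyc A hA (by rw [he]; exact zmod_two_ne_zero.1 hp)
        -- A code that is nonzero and not an odd shift makes the position sturdy by itself.
        obtain ⟨q, hq, hq0, hs, hn⟩ := exists_lt_not_oddShift hA0 hp
        obtain ⟨t, ht, -, hbel, hd, hc⟩ := exists_odd_deletion hq hs
        exact exists_zeroPosition_of_vertex hv (mem_verts_of_degParity hd) (by rw [hd, he])
          fun _ => ⟨A, hA, by rw [hc]; exact hq0, fun ho => absurd (hc ▸ ho) hn⟩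

theorem nimValue_eq_zero_iff_zeroPosition (R : Unicyclic C) (H : G.Subgraph) :
    nimValue H = 0 ↔ R.ZeroPosition H :=
  nimValue_eq_zero_iff_of_kernel R.ZeroPosition (fun _ _ h hH => not_zeroPosition_of_isMove h hH)
    (fun H hH => by
      by_cases hC : C ≤ H
      · exact exists_zeroPosition_of_le hC hH
      · exact exists_zeroPosition_of_not_le hC hH) H

end Unicyclic

/-! ### Invariance of the codes under cancellation -/

namespace Unicyclic

variable {V : Type*} [Fintype V] {G : SimpleGraph V} {C : G.Subgraph} {R : Unicyclic C}
  {H K : G.Subgraph} {x y z t A B : V}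

theorem par_par_ne (hxy : x ≠ y) (h1 : R.par x = y) (h2 : R.par y = x) : False := by
  have h3 := R.lev_par x (by rw [h1]; exact hxy.symm)
  have h4 := R.lev_par y (by rw [h2]; exact hxy)
  rw [h1] at h3
  rw [h2] at h4
  omega

/-- `F` maps `S` isomorphically onto `T`, as induced subgraphs of `H`. -/
structure IsInducedIso (H : G.Subgraph) (S T : Set V) (F : V → V) : Prop where
  maps : ∀ x ∈ S, F x ∈ T
  inj : ∀ x ∈ S, ∀ y ∈ S, F x = F y → x = y
  surj : ∀ y ∈ T, ∃ x ∈ S, F x = y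
  adj : ∀ x ∈ S, ∀ y ∈ S, H.Adj (F x) (F y) ↔ H.Adj x y

theorem exists_isInducedIso {S T : Set V} (f : (H.induce S).coe ≃g (H.induce T).coe) {v w : V}
    (hv : v ∈ S) (hw : w ∈ T) (hf : f ⟨v, hv⟩ = ⟨w, hw⟩) :
    ∃ F : V → V, IsInducedIso H S T F ∧ F v = w := by
  classical
  let F : V → V := fun x => if h : x ∈ S then (f ⟨x, h⟩).1 else x
  have hF : ∀ x (h : x ∈ S), F x = (f ⟨x, h⟩).1 := fun x h => dif_pos h
  refine ⟨F, ⟨fun x h => ?_, fun x hx y hy h => ?_, fun y hy => ?_, fun x hx y hy => ?_⟩, ?_⟩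
  · rw [hF x h]
    exact (f ⟨x, h⟩).2
  · rw [hF x hx, hF y hy] at h
    exact congrArg Subtype.val (f.injective (Subtype.ext h))
  · obtain ⟨⟨x, hx⟩, h⟩ := f.surjective ⟨y, hy⟩
    exact ⟨x, hx, by rw [hF x hx, h]⟩
  · rw [hF x hx, hF y hy]
    have := f.map_adj_iff (v := ⟨x, hx⟩) (w := ⟨y, hy⟩)
    simp only [SimpleGraph.Subgraph.coe_adj, SimpleGraph.Subgraph.induce_adj] at this
    constructor
    · exact fun h => (this.1 ⟨(f ⟨x, hx⟩).2, (f ⟨y, hy⟩).2, h⟩).2.2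
    · exact fun h => (this.2 ⟨hx, hy, h⟩).2.2
  · rw [hF v hv, hf]

/-- A cut-off part with a disjoint isomorphic copy does not meet the cycle. -/
theorem disjoint_cycle (R : Unicyclic C) (hC : C ≤ H) {S T : Set V} {F : V → V} {s v : V}
    (hF : IsInducedIso H S T F) (hST : Disjoint S T)
    (hS : ∀ x ∈ S, ∀ y ∉ S, H.Adj x y → x = v ∧ y = s) : Disjoint C.verts S := by
  refine (R.cut S v s fun x hx y hy h => hS x hx y hy (hC.2 h)).resolve_left fun hsub => ?_
  have hT : ∀ x ∈ C.verts, F x ∉ C.verts := fun x hx hFx =>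
    Set.disjoint_left.1 hST (hsub hFx) (hF.maps x (hsub hx))
  have hne : C.verts.Nonempty := by
    rw [← Set.ncard_pos]
    exact lt_trans (by norm_num) R.two_lt_card_cycle
  -- If the part contained the cycle, its copy would contain a cycle off `C`. At a vertex of highest
  -- level there, both neighbours would have to be the parent.
  obtain ⟨w, hw, hmax⟩ := Set.exists_max_image C.verts (fun x => R.lev (F x)) (Set.toFinite _) hne
  have key : ∀ y, C.Adj w y → R.par (F w) = F y := by
    intro y hy
    have h1 : H.Adj (F w) (F y) := (hF.adj w (hsub hw) y (hsub hy.snd_mem)).2 (hC.2 hy)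
    rcases adj_cases (R := R) h1 with hc | hc | hc
    · exact absurd hc.fst_mem (hT w hw)
    · exact (mem_children_branch.1 hc).1
    · have := hmax y hy.snd_mem
      have := Rooting.lev_of_mem_children hc
      omega
  obtain ⟨a, b, ha, hb, hab⟩ := (Set.one_lt_ncard_iff (Set.toFinite _)).1
    (show 1 < (C.neighborSet w).ncard by rw [R.ncard_neighborSet w hw]; norm_num)
  refine hab (hF.inj a (hsub ?_) b (hsub ?_) ((key a ha).symm.trans (key b hb)))
  · exact SimpleGraph.Subgraph.Adj.snd_mem ha
  · exact SimpleGraph.Subgraph.Adj.snd_mem hb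

/-- Isomorphic branches have the same code. -/
theorem treeCode_eq_of_isInducedIso {S T : Set V} {F : V → V} {s v w : V}
    (hF : IsInducedIso H S T F) (hv : v ∈ S) (hFv : F v = w) (hsS : s ∉ S) (hsT : s ∉ T)
    (hS : ∀ x ∈ S, ∀ y ∉ S, H.Adj x y → x = v ∧ y = s)
    (hT : ∀ x ∈ T, ∀ y ∉ T, H.Adj x y → x = w ∧ y = s)
    (hCS : Disjoint C.verts S) (hCT : Disjoint C.verts T)
    (hpv : R.par v = s) (hpw : R.par w = s) : R.treeCode H v = R.treeCode H w := by
  classical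
  -- The hypotheses say that `F` respects parents at `z`. This passes to the children, since the
  -- edge to the parent is already accounted for.
  have main : ∀ z, z ∈ S → (z = v → R.par (F z) = s) →
      (z ≠ v → R.par (F z) = F (R.par z) ∧ R.par z ∈ S) →
      R.treeCode H z = R.treeCode H (F z) := by
    intro z
    induction z using R.child_induction with
    | h z ih =>
      intro hz h1 h2
      have hchild : ∀ y ∈ R.children (R.branch H) z,
          y ∈ S ∧ R.par y = z ∧ H.Adj (F y) (F z) ∧ R.par (F y) = F z ∧ y ≠ v := by
        intro y hy
        obtain ⟨hpy, hadj⟩ := mem_children_branch.1 hy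
        have hyv : y ≠ v := by
          rintro rfl
          exact hsS (hpv ▸ hpy ▸ hz)
        have hyS : y ∈ S := by
          by_contra hyS
          obtain ⟨rfl, rfl⟩ := hS z hz y hyS hadj.symm
          exact par_par_ne hyv hpy hpv
        have hadj' := (hF.adj y hyS z hz).2 hadj
        refine ⟨hyS, hpy, hadj', ?_, hyv⟩
        rcases adj_cases (R := R) hadj' with hc | hc | hc
        · exact absurd hc.fst_mem fun h => Set.disjoint_left.1 hCT h (hF.maps y hyS)
        · exact (mem_children_branch.1 hc).1
        · have hpz := (mem_children_branch.1 hc).1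
          by_cases hzv : z = v
          · rw [h1 hzv] at hpz
            exact absurd (hF.maps y hyS) (hpz ▸ hsT)
          · obtain ⟨h3, h4⟩ := h2 hzv
            have := hF.inj _ h4 _ hyS (h3.symm.trans hpz)
            exact (par_par_ne hadj.ne hpy this).elim
      have himage : R.children (R.branch H) (F z) = (R.children (R.branch H) z).image F := by
        ext u
        rw [Finset.mem_image]
        constructor
        · intro hu
          obtain ⟨hpu, hadj⟩ := mem_children_branch.1 hu
          have huT : u ∈ T := by
            by_contra huT
            obtain ⟨h3, rfl⟩ := hT (F z) (hF.maps z hz) u huT hadj.symm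
            exact par_par_ne hadj.ne hpu (h3 ▸ hpw)
          obtain ⟨y, hyS, rfl⟩ := hF.surj u huT
          have hadj' := (hF.adj y hyS z hz).1 hadj
          refine ⟨y, ?_, rfl⟩
          rcases adj_cases (R := R) hadj' with hc | hc | hc
          · exact absurd hc.fst_mem fun h => Set.disjoint_left.1 hCS h hyS
          · exact hc
          · have hpz := (mem_children_branch.1 hc).1
            have hzv : z ≠ v := by
              rintro rfl
              exact hsS (hpv ▸ hpz ▸ hyS)
            refine (par_par_ne hadj.ne hpu ?_).elim
            rw [(h2 hzv).1, hpz]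
        · rintro ⟨y, hy, rfl⟩
          obtain ⟨_, _, h3, h4, _⟩ := hchild y hy
          exact mem_children_branch.2 ⟨h4, h3⟩
      unfold treeCode
      rw [Rooting.code_eq, Rooting.code_eq, himage, Finset.sum_image fun a ha b hb h =>
        hF.inj a (hchild a ha).1 b (hchild b hb).1 h]
      refine Finset.sum_congr rfl fun y hy => ?_
      obtain ⟨h3, h4, _, h5, h6⟩ := hchild y hy
      have := ih y (Rooting.mem_children_univ hy) h3 (fun h => absurd h h6)
        fun _ => ⟨by rw [h5, h4], by rw [h4]; exact hz⟩
      unfold treeCode at this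
      rw [this]
  rw [main v hv (fun _ => by rw [hFv, hpw]) (fun h => absurd rfl h), hFv]

theorem mem_children_deleteVerts {S : Set V} (hx : x ∉ S) :
    y ∈ R.children (R.branch (H.deleteVerts S)) x ↔ y ∉ S ∧ y ∈ R.children (R.branch H) x := by
  rw [mem_children_branch, mem_children_branch, SimpleGraph.Subgraph.deleteVerts_adj]
  constructor
  · rintro ⟨h1, h2⟩
    exact ⟨h2.2.1, h1, h2.2.2.2.2⟩
  · rintro ⟨h1, h2, h3⟩
    exact ⟨h2, h3.fst_mem, h1, h3.snd_mem, hx, h3⟩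

/-- The removed parts are attached only at `s`, so no ancestor chain leads from them to `x` without
passing through `s`. -/
theorem treeCode_of_cancel_of_not_below {S T : Set V} {s v w : V}
    (hS : ∀ x ∈ S, ∀ y ∉ S, H.Adj x y → x = v ∧ y = s)
    (hT : ∀ x ∈ T, ∀ y ∉ T, H.Adj x y → x = w ∧ y = s) (x : V) :
    x ∉ S ∪ T → ¬ R.Below (R.branch H) s x →
      R.treeCode (H.deleteVerts (S ∪ T)) x = R.treeCode H x := by
  induction x using R.child_induction with
  | h x ih =>
    intro hx hb
    have hsub : ∀ y ∈ R.children (R.branch H) x, y ∉ S ∪ T := by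
      rintro y hy (hyS | hyT)
      · refine hb ?_
        rw [(hS y hyS x (fun h => hx (Or.inl h)) (mem_children_branch.1 hy).2).2]
        exact Relation.ReflTransGen.refl
      · refine hb ?_
        rw [(hT y hyT x (fun h => hx (Or.inr h)) (mem_children_branch.1 hy).2).2]
        exact Relation.ReflTransGen.refl
    have heq : R.children (R.branch (H.deleteVerts (S ∪ T))) x = R.children (R.branch H) x := by
      ext y
      rw [mem_children_deleteVerts hx]
      exact ⟨fun h => h.2, fun h => ⟨hsub y h, h⟩⟩
    unfold treeCode at ih ⊢
    rw [Rooting.code_eq, Rooting.code_eq, heq]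
    exact Finset.sum_congr rfl fun y hy => by
      rw [ih y (Rooting.mem_children_univ hy) (hsub y hy) fun h => hb (h.parent hy)]

/-- The two removed branches contribute the same power of two to the code of `s`, and these terms
cancel in the nim sum. -/
theorem treeCode_of_cancel_of_par {S T : Set V} {s v w : V} (hST : Disjoint S T)
    (hv : v ∈ S) (hw : w ∈ T) (hsS : s ∉ S) (hsT : s ∉ T) (hsv : H.Adj s v) (hsw : H.Adj s w)
    (hS : ∀ x ∈ S, ∀ y ∉ S, H.Adj x y → x = v ∧ y = s)
    (hT : ∀ x ∈ T, ∀ y ∉ T, H.Adj x y → x = w ∧ y = s)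
    (hpv : R.par v = s) (hpw : R.par w = s) (hc : R.treeCode H v = R.treeCode H w) (x : V) :
    x ∉ S ∪ T → R.treeCode (H.deleteVerts (S ∪ T)) x = R.treeCode H x := by
  classical
  induction x using R.child_induction with
  | h x ih =>
    intro hx
    have hxS : x ∉ S := fun h => hx (Or.inl h)
    have hxT : x ∉ T := fun h => hx (Or.inr h)
    have hih : ∀ y ∈ R.children (R.branch (H.deleteVerts (S ∪ T))) x,
        bit (R.treeCode (H.deleteVerts (S ∪ T)) y) = bit (R.treeCode H y) := fun y hy => by
      rw [ih y (Rooting.mem_children_univ hy) ((mem_children_deleteVerts hx).1 hy).1]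
    unfold treeCode at hih hc ⊢
    rw [Rooting.code_eq, Rooting.code_eq, Finset.sum_congr rfl hih]
    by_cases hxs : x = s
    · subst hxs
      have hvw : v ≠ w := fun h => Set.disjoint_left.1 hST hv (h ▸ hw)
      have heq : R.children (R.branch H) x =
          insert v (insert w (R.children (R.branch (H.deleteVerts (S ∪ T))) x)) := by
        ext y
        rw [Finset.mem_insert, Finset.mem_insert, mem_children_deleteVerts hx]
        constructor
        · intro hy
          by_cases hyS : y ∈ S
          · exact Or.inl (hS y hyS x hxS (mem_children_branch.1 hy).2).1
          · by_cases hyT : y ∈ T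
            · exact Or.inr (Or.inl (hT y hyT x hxT (mem_children_branch.1 hy).2).1)
            · exact Or.inr (Or.inr ⟨fun h => h.elim hyS hyT, hy⟩)
        · rintro (rfl | rfl | h)
          · exact mem_children_branch.2 ⟨hpv, hsv.symm⟩
          · exact mem_children_branch.2 ⟨hpw, hsw.symm⟩
          · exact h.2
      have hnw : w ∉ R.children (R.branch (H.deleteVerts (S ∪ T))) x := fun h =>
        ((mem_children_deleteVerts hx).1 h).1 (Or.inr hw)
      have hnv : v ∉ insert w (R.children (R.branch (H.deleteVerts (S ∪ T))) x) := fun h => by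
        rcases Finset.mem_insert.1 h with h | h
        · exact hvw h
        · exact ((mem_children_deleteVerts hx).1 h).1 (Or.inl hv)
      rw [heq, Finset.sum_insert hnv, Finset.sum_insert hnw, hc, add_add_cancel_left]
    · have heq : R.children (R.branch (H.deleteVerts (S ∪ T))) x = R.children (R.branch H) x := by
        ext y
        rw [mem_children_deleteVerts hx]
        refine ⟨fun h => h.2, fun h => ⟨?_, h⟩⟩
        rintro (hy | hy)
        · exact hxs (hS y hy x hxS (mem_children_branch.1 h).2).2
        · exact hxs (hT y hy x hxT (mem_children_branch.1 h).2).2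
      rw [heq]

/-- A vertex whose parent lies in a part of the graph that is cut off by the edge to the parent
is not connected to the cycle. -/
theorem not_below_of_par_mem {S : Set V} {s v : V} (hA : A ∈ C.verts) (hv : v ∈ S) (hsS : s ∉ S)
    (hS : ∀ x ∈ S, ∀ y ∉ S, H.Adj x y → x = v ∧ y = s) (hCS : Disjoint C.verts S)
    (hps : R.par s = v) (hsA : s ≠ A) : ¬ R.Below (R.branch H) s A := by
  intro hb
  rcases Relation.ReflTransGen.cases_head hb with h | ⟨c, hc, hcA⟩
  · exact hsA h
  · have hcv : c = v := (mem_children_branch.1 hc).1.symm.trans hps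
    subst hcv
    have key : ∀ z, R.Below (R.branch H) c z → z ∈ S := by
      intro z hz
      induction hz with
      | refl => exact hv
      | @tail a b _ hab ih =>
        by_contra hbS
        obtain ⟨hpa, hadj⟩ := mem_children_branch.1 hab
        obtain ⟨rfl, rfl⟩ := hS a ih b hbS hadj
        exact par_par_ne hadj.ne hpa hps
    exact Set.disjoint_left.1 hCS hA (key A hcA)

/-- Cancellation neither affects the cycle nor the codes of the trees attached to it. -/
theorem cancelsTo_invariant (R : Unicyclic C) (hC : C ≤ H) (h : CancelsTo H K) :
    C ≤ K ∧ K ≤ H ∧ ∀ A ∈ C.verts, R.treeCode K A = R.treeCode H A := by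
  obtain ⟨s, v, w, S, T, hv, hw, _, _, hST, hsS, hsT, hsv, hsw, hS, hT, ⟨f, hf⟩, rfl⟩ := h
  obtain ⟨F, hF, hFv⟩ := exists_isInducedIso f hv hw hf
  obtain ⟨F', hF', -⟩ := exists_isInducedIso f.symm hw hv (by rw [← hf, f.symm_apply_apply])
  have hCS := R.disjoint_cycle hC hF hST hS
  have hCT := R.disjoint_cycle hC hF' hST.symm hT
  have hCU : ∀ A ∈ C.verts, A ∉ S ∪ T := fun A hA h =>
    h.elim (Set.disjoint_left.1 hCS hA) (Set.disjoint_left.1 hCT hA)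
  refine ⟨⟨fun a ha => ⟨hC.1 ha, hCU a ha⟩, fun a b hab => ?_⟩,
    SimpleGraph.Subgraph.deleteVerts_le, fun A hA => ?_⟩
  · rw [SimpleGraph.Subgraph.deleteVerts_adj]
    exact ⟨hC.1 hab.fst_mem, hCU a hab.fst_mem, hC.1 hab.snd_mem, hCU b hab.snd_mem, hC.2 hab⟩
  · have hpar : ∀ {S : Set V} {v : V}, v ∈ S → Disjoint C.verts S → H.Adj s v →
        R.par v = s ∨ (R.par s = v ∧ s ∉ C.verts) := by
      intro S v hv hCS hsv
      rcases adj_cases (R := R) hsv with hc | hc | hc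
      · exact absurd hv (Set.disjoint_left.1 hCS hc.snd_mem)
      · exact Or.inr ⟨(mem_children_branch.1 hc).1,
          notMem_cycle_of_mem_branch (Rooting.mem_children.1 hc).1⟩
      · exact Or.inl (mem_children_branch.1 hc).1
    -- Either both parts hang below `s` and their codes cancel, or one of them contains the parent
    -- of `s`. In the latter case `s` is cut off from the cycle, and no code on the cycle sees the
    -- change.
    rcases hpar hv hCS hsv with hpv | ⟨hps, hsC⟩
    · rcases hpar hw hCT hsw with hpw | ⟨hps, hsC⟩
      · exact treeCode_of_cancel_of_par hST hv hw hsS hsT hsv hsw hS hT hpv hpw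
          (treeCode_eq_of_isInducedIso hF hv hFv hsS hsT hS hT hCS hCT hpv hpw) A (hCU A hA)
      · exact treeCode_of_cancel_of_not_below hS hT A (hCU A hA)
          (not_below_of_par_mem hA hw hsT hT hCT hps fun h => hsC (h ▸ hA))
    · exact treeCode_of_cancel_of_not_below hS hT A (hCU A hA)
        (not_below_of_par_mem hA hv hsS hS hCS hps fun h => hsC (h ▸ hA))

theorem reduction_invariant (R : Unicyclic C) (hC : C ≤ H)
    (h : Relation.ReflTransGen CancelsTo H K) :
    C ≤ K ∧ K ≤ H ∧ ∀ A ∈ C.verts, R.treeCode K A = R.treeCode H A := by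
  induction h with
  | refl => exact ⟨hC, le_rfl, fun _ _ => rfl⟩
  | tail _ h ih =>
    obtain ⟨h1, h2, h3⟩ := ih
    obtain ⟨h4, h5, h6⟩ := R.cancelsTo_invariant h1 h
    exact ⟨h4, h5.trans h2, fun A hA => (h6 A hA).trans (h3 A hA)⟩

end Unicyclic

theorem CancelsTo.lt {V : Type*} {G : SimpleGraph V} {H K : G.Subgraph} (h : CancelsTo H K) :
    K < H := by
  obtain ⟨s, v, w, S, T, hv, hw, hSH, _, _, _, _, _, _, _, _, _, rfl⟩ := h
  refine lt_of_le_of_ne SimpleGraph.Subgraph.deleteVerts_le fun heq => ?_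
  have : v ∈ (H.deleteVerts (S ∪ T)).verts := by rw [heq]; exact hSH hv
  exact this.2 (Or.inl hv)

theorem exists_reducesTo {V : Type*} [Finite V] {G : SimpleGraph V} (H : G.Subgraph) :
    ∃ K, ReducesTo H K := by
  induction H using WellFoundedLT.induction with
  | ind H ih =>
    by_cases h : IsReduced H
    · exact ⟨H, Relation.ReflTransGen.refl, h⟩
    · obtain ⟨K, hK⟩ := not_not.1 h
      obtain ⟨L, hL, hr⟩ := ih K hK.lt
      exact ⟨L, Relation.ReflTransGen.head hK hL, hr⟩

/-! ### Equal codes in a reduced graph -/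

namespace Unicyclic

variable {V : Type*} [Fintype V] {G : SimpleGraph V} {C : G.Subgraph} {R : Unicyclic C}
  {H K : G.Subgraph} {x y z v w v' w' A B : V}

/-- The descendants of `y` and `z` that correspond to each other under the codes. -/
inductive Matched (R : Unicyclic C) (H : G.Subgraph) (y z : V) : V → V → Prop
  | base : Matched R H y z y z
  | step {w w' v v' : V} (h : Matched R H y z w w') (hv : v ∈ R.children (R.branch H) w)
      (hv' : v' ∈ R.children (R.branch H) w') (hc : R.treeCode H v = R.treeCode H v') :
      Matched R H y z v v'

theorem Matched.symm (h : R.Matched H y z w w') : R.Matched H z y w' w := by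
  induction h with
  | base => exact .base
  | step _ hv hv' hc ih => exact .step ih hv' hv hc.symm

theorem Matched.treeCode_eq (hc : R.treeCode H y = R.treeCode H z) (h : R.Matched H y z w w') :
    R.treeCode H w = R.treeCode H w' := by
  cases h with
  | base => exact hc
  | step _ _ _ h => exact h

theorem Matched.below_left (h : R.Matched H y z w w') : R.Below (R.branch H) w y := by
  induction h with
  | base => exact Relation.ReflTransGen.refl
  | step _ hv _ _ ih => exact Relation.ReflTransGen.head hv ih

theorem Matched.below_right (h : R.Matched H y z w w') : R.Below (R.branch H) w' z :=
  h.symm.below_left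

/-- When siblings have different codes, the digits of the code of a vertex are the codes of its
children. -/
theorem digit_treeCode_of_mem_children
    (hinj : Set.InjOn (R.treeCode H) (R.children (R.branch H) x))
    (hy : y ∈ R.children (R.branch H) x) : digit (R.treeCode H x) (R.treeCode H y) = true := by
  have h1 : digitHom (R.treeCode H y) (R.treeCode H x) = 1 := by
    unfold treeCode at hinj ⊢
    rw [R.code_eq (R.branch H) x, map_sum, Finset.sum_eq_single y]
    · rw [digitHom_apply, if_pos ((digit_bit _ _).2 rfl)]
    · intro u hu hne
      rw [digitHom_apply, digit_bit_of_ne fun h => hne (hinj hu hy h)]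
      simp
    · exact fun h => absurd hy h
  rw [digitHom_apply] at h1
  by_contra hd
  rw [if_neg hd] at h1
  simp at h1

/-- The graph is reduced below `x`. -/
def DistinctBelow (R : Unicyclic C) (H : G.Subgraph) (y : V) : Prop :=
  ∀ u, R.lev y ≤ R.lev u → Set.InjOn (R.treeCode H) (R.children (R.branch H) u)

theorem Matched.exists_child (hd : R.DistinctBelow H y) (hc : R.treeCode H y = R.treeCode H z)
    (h : R.Matched H y z w w') (hv : v ∈ R.children (R.branch H) w) :
    ∃ v' ∈ R.children (R.branch H) w', R.Matched H y z v v' := by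
  have h1 := digit_treeCode_of_mem_children (hd w h.below_left.lev_le) hv
  rw [h.treeCode_eq hc] at h1
  obtain ⟨v', hv', h2⟩ := Rooting.exists_child_of_digit h1
  exact ⟨v', hv', .step h hv hv' h2.symm⟩

theorem exists_matched (hd : R.DistinctBelow H y) (hc : R.treeCode H y = R.treeCode H z)
    (hw : R.Below (R.branch H) w y) : ∃ w', R.Matched H y z w w' := by
  induction hw using Relation.ReflTransGen.head_induction_on with
  | refl => exact ⟨z, .base⟩
  | head hv _ ih =>
    obtain ⟨u', hu'⟩ := ih
    obtain ⟨v', _, h⟩ := hu'.exists_child hd hc hv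
    exact ⟨v', h⟩

/-- Children with equal codes under the same vertex coincide, so the correspondence is determined
level by level. -/
theorem Matched.unique (hd : R.DistinctBelow H z) (h : R.Matched H y z w w')
    {w'' : V} (h' : R.Matched H y z w w'') : w' = w'' := by
  induction h generalizing w'' with
  | base =>
    cases h' with
    | base => rfl
    | step hu hv _ _ =>
      have h1 := Rooting.lev_of_mem_children hv
      have h2 := hu.below_left.lev_le
      omega
  | @step u u' v v' hu hv hv' hc ih =>
    cases h' with
    | base =>
      have h1 := Rooting.lev_of_mem_children hv
      have h2 := hu.below_left.lev_le
      omega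
    | @step a a' _ _ ha hva hva' hca =>
      have hau : u = a := (mem_children_branch.1 hv).1.symm.trans (mem_children_branch.1 hva).1
      subst hau
      have := ih ha
      subst this
      exact hd u' hu.below_right.lev_le hv' hva' (hc.symm.trans hca)

theorem notMem_cycle_of_below (hy : y ∈ R.branch H) (h : R.Below (R.branch H) w y) :
    w ∉ C.verts := by
  by_cases hwy : w = y
  · exact hwy ▸ notMem_cycle_of_mem_branch hy
  · exact notMem_cycle_of_mem_branch (h.mem hwy)

theorem Matched.adj (hd : R.DistinctBelow H y) (hd' : R.DistinctBelow H z)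
    (hc : R.treeCode H y = R.treeCode H z) (hy : y ∈ R.branch H)
    (hw : R.Matched H y z w w') (hv : R.Matched H y z v v') (h : H.Adj w v) : H.Adj w' v' := by
  have main : ∀ {w w' v v' : V}, R.Matched H y z w w' → R.Matched H y z v v' →
      v ∈ R.children (R.branch H) w → H.Adj v' w' := by
    intro w w' v v' hw hv h
    obtain ⟨u, hu, hm⟩ := hw.exists_child hd hc h
    rw [hv.unique hd' hm]
    exact (mem_children_branch.1 hu).2
  rcases adj_cases (R := R) h with h | h | h
  · exact absurd h.fst_mem (notMem_cycle_of_below hy hw.below_left)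
  · exact main hv hw h
  · exact (main hw hv h).symm

/-- Siblings with the same code have isomorphic branches. -/
theorem exists_iso_of_treeCode_eq (hd : R.DistinctBelow H y) (hd' : R.DistinctBelow H z)
    (hc : R.treeCode H y = R.treeCode H z) (hy : y ∈ R.branch H) (hz : z ∈ R.branch H) :
    ∃ f : (H.induce {w | R.Below (R.branch H) w y}).coe ≃g
      (H.induce {w | R.Below (R.branch H) w z}).coe,
      f ⟨y, Relation.ReflTransGen.refl⟩ = ⟨z, Relation.ReflTransGen.refl⟩ := by
  classical
  choose F hF using fun w : {w | R.Below (R.branch H) w y} => exists_matched hd hc w.2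
  choose F' hF' using fun w : {w | R.Below (R.branch H) w z} => exists_matched hd' hc.symm w.2
  let e : {w | R.Below (R.branch H) w y} ≃ {w | R.Below (R.branch H) w z} :=
    { toFun := fun w => ⟨F w, (hF w).below_right⟩
      invFun := fun w => ⟨F' w, (hF' w).below_right⟩
      left_inv := fun w => Subtype.ext ((hF' _).unique hd (hF w).symm)
      right_inv := fun w => Subtype.ext ((hF _).unique hd' (hF' w).symm) }
  refine ⟨⟨e, ?_⟩, Subtype.ext ((hF _).unique hd' .base)⟩
  intro a b
  constructor
  · intro h
    exact ⟨a.2, b.2, Matched.adj hd' hd hc.symm hz (hF a).symm (hF b).symm h.2.2⟩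
  · intro h
    exact ⟨(hF a).below_right, (hF b).below_right, Matched.adj hd hd' hc hy (hF a) (hF b) h.2.2⟩

/-- The only edge that leaves the branch of `y` is the edge to the parent. -/
theorem eq_of_adj_of_below (hy : y ∈ R.children (R.branch H) x)
    (hv : R.Below (R.branch H) v y) (hw : ¬ R.Below (R.branch H) w y) (h : H.Adj v w) :
    v = y ∧ w = x := by
  rcases adj_cases (R := R) h with h | h | h
  · exact absurd h.fst_mem (notMem_cycle_of_below (Rooting.mem_children.1 hy).1 hv)
  · rcases Relation.ReflTransGen.cases_head hv with rfl | ⟨u, hu, huy⟩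
    · exact ⟨rfl, (mem_children_branch.1 h).1.symm.trans (mem_children_branch.1 hy).1⟩
    · have : u = w := (mem_children_branch.1 hu).1.symm.trans (mem_children_branch.1 h).1
      exact absurd (this ▸ huy) hw
  · exact absurd (Relation.ReflTransGen.head h hv) hw

/-- In a reduced graph, siblings have different codes. -/
theorem injOn_treeCode_of_isReduced (R : Unicyclic C) (hH : IsReduced H) (x : V) :
    Set.InjOn (R.treeCode H) (R.children (R.branch H) x) := by
  by_contra hx
  -- A violation at the greatest distance from the root is chosen: further out, siblings have
  -- distinct codes, so equal codes at `x` give isomorphic branches, that is, a cancellation.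
  obtain ⟨x, hx, hmax⟩ := Set.exists_max_image
    {x | ¬ Set.InjOn (R.treeCode H) (R.children (R.branch H) x)} R.lev (Set.toFinite _) ⟨x, hx⟩
  have hd : ∀ y ∈ R.children (R.branch H) x, R.DistinctBelow H y := by
    intro y hy u hu
    by_contra hc
    have h1 := hmax u hc
    have h2 := Rooting.lev_of_mem_children hy
    omega
  refine hx fun y hy z hz hc => ?_
  by_contra hne
  have hyb := (Rooting.mem_children.1 hy).1
  have hzb := (Rooting.mem_children.1 hz).1
  obtain ⟨f, hf⟩ := exists_iso_of_treeCode_eq (hd y hy) (hd z hz) hc hyb hzb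
  have hsub : ∀ {y}, y ∈ R.branch H → {w | R.Below (R.branch H) w y} ⊆ H.verts := by
    intro y hy w hw
    by_cases hwy : w = y
    · rw [hwy]
      exact SimpleGraph.Subgraph.Adj.fst_mem (show H.Adj y (R.par y) from hy)
    · exact SimpleGraph.Subgraph.Adj.fst_mem (show H.Adj w (R.par w) from hw.mem hwy)
  have hnb : ∀ {y}, y ∈ R.children (R.branch H) x → ¬ R.Below (R.branch H) x y := by
    intro y hy hb
    have h1 := Rooting.lev_of_mem_children hy
    have h2 := hb.lev_le
    omega
  refine hH ⟨_, x, y, z, {w | R.Below (R.branch H) w y}, {w | R.Below (R.branch H) w z},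
    Relation.ReflTransGen.refl, Relation.ReflTransGen.refl, hsub hyb, hsub hzb, ?_, hnb hy,
    hnb hz, (mem_children_branch.1 hy).2.symm, (mem_children_branch.1 hz).2.symm,
    fun v hv w hw h => eq_of_adj_of_below hy hv hw h,
    fun v hv w hw h => eq_of_adj_of_below hz hv hw h, ⟨f, hf⟩, rfl⟩
  rw [Set.disjoint_left]
  intro w hw hw'
  refine hne (hw.unique hw' ?_)
  rw [Rooting.lev_of_mem_children hy, Rooting.lev_of_mem_children hz]

/-- Distinct codes of siblings give distinct powers of two, so no terms of the nim sum cancel. -/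
theorem treeCode_eq_zero_iff_of_isReduced (R : Unicyclic C) (hH : IsReduced H) (x : V) :
    R.treeCode H x = 0 ↔ R.children (R.branch H) x = ∅ := by
  constructor
  · intro h0
    rw [Finset.eq_empty_iff_forall_notMem]
    intro y hy
    have := digit_treeCode_of_mem_children (R.injOn_treeCode_of_isReduced hH x) hy
    rw [h0, digit_zero] at this
    simp at this
  · intro h
    unfold treeCode
    rw [Rooting.code_eq, h, Finset.sum_empty]

end Unicyclic

/-! ### Rooting a forest -/

section RootedForest

/-- A forest in which a set `S` contains at most one vertex of each component can be rooted such
that the vertices of `S` are roots. -/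
theorem exists_rooting {V : Type*} {F : SimpleGraph V} (hF : F.IsAcyclic) {S : Set V}
    (hS : ∀ a ∈ S, ∀ b ∈ S, F.Reachable a b → a = b) :
    ∃ R : Rooting V, (∀ a ∈ S, R.par a = a) ∧
      ∀ x y, F.Adj x y ↔ x ≠ y ∧ (R.par x = y ∨ R.par y = x) := by
  classical
  have hroot : ∀ c : F.ConnectedComponent, ∃ r, F.connectedComponentMk r = c ∧
      ∀ a ∈ S, F.connectedComponentMk a = c → r = a := by
    intro c
    by_cases h : ∃ a ∈ S, F.connectedComponentMk a = c
    · obtain ⟨a, ha, hac⟩ := h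
      exact ⟨a, hac, fun b hb hbc => hS a ha b hb
        (SimpleGraph.ConnectedComponent.exact (hac.trans hbc.symm))⟩
    · obtain ⟨r, hr⟩ := c.exists_rep
      exact ⟨r, hr, fun a ha hac => absurd ⟨a, ha, hac⟩ h⟩
  choose rt hrt hrtS using hroot
  let root : V → V := fun x => rt (F.connectedComponentMk x)
  have hpath : ∀ x, ∃ p : F.Walk (root x) x, p.IsPath := fun x =>
    (SimpleGraph.ConnectedComponent.exact (hrt (F.connectedComponentMk x))).exists_isPath
  choose p hp using hpath
  have huniq : ∀ {r x : V} (q : F.Walk r x), q.IsPath → r = root x →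
      (p x).penultimate = q.penultimate ∧ (p x).length = q.length := by
    rintro r x q hq rfl
    have := (hF.subsingleton_path (root x) x).elim ⟨p x, hp x⟩ ⟨q, hq⟩
    rw [Subtype.mk.injEq] at this
    rw [this]
    exact ⟨rfl, rfl⟩
  have hadjroot : ∀ {x y}, F.Adj x y → root x = root y := fun {x y} h => by
    change rt _ = rt _
    rw [SimpleGraph.ConnectedComponent.eq.2 h.reachable]
  have hnil : ∀ x, (p x).penultimate ≠ x → ¬ (p x).Nil := by
    intro x hx h
    refine hx ?_
    have h1 : (p x).length = 0 := SimpleGraph.Walk.length_eq_zero_iff.2 h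
    have h2 : (p x).penultimate = root x := by
      unfold SimpleGraph.Walk.penultimate
      rw [h1]
      exact SimpleGraph.Walk.getVert_zero _
    rw [h2]
    exact h.eq
  have hadjpar : ∀ x, (p x).penultimate ≠ x → F.Adj (p x).penultimate x := fun x hx =>
    SimpleGraph.Walk.adj_penultimate (hnil x hx)
  let R : Rooting V :=
    -- The parent is the last vertex but one on the unique path from the root. For the trivial path
    -- this is the root itself, which makes it a fixed point.
    { par := fun x => (p x).penultimate
      lev := fun x => (p x).length
      lev_par := by
        intro x hx
        have h1 := hadjpar x hx
        have h2 := (huniq (p x).dropLast (hp x).dropLast (hadjroot h1).symm).2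
        have h3 : (p x).length ≠ 0 := fun h =>
          hnil x hx (SimpleGraph.Walk.length_eq_zero_iff.1 h)
        rw [h2, SimpleGraph.Walk.length_dropLast]
        omega
      lev_root := by
        intro x hx
        by_contra h
        have h1 : ¬ (p x).Nil := fun hn => h (SimpleGraph.Walk.length_eq_zero_iff.2 hn)
        exact (SimpleGraph.Walk.adj_penultimate h1).ne hx }
  refine ⟨R, fun a ha => ?_, fun x y => ⟨fun h => ⟨h.ne, ?_⟩, ?_⟩⟩
  · exact (huniq (SimpleGraph.Walk.nil : F.Walk a a) SimpleGraph.Walk.IsPath.nil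
      (hrtS _ a ha rfl).symm).1
  · have key : ∀ {x y} (h : F.Adj x y) (q : F.Walk (root x) y), q.IsPath → x ∈ q.support →
        (p y).penultimate = x := by
      intro x y h q hq hx
      have := hF.path_concat (hp x) hq h hx
      rw [(huniq q hq (hadjroot h)).1, this, SimpleGraph.Walk.penultimate_concat]
    -- Of two adjacent vertices of a forest, one lies on the path from the root to the other.
    by_cases hx : x ∈ ((p y).copy (hadjroot h).symm rfl).support
    · exact Or.inr (key h _ (by simpa using hp y) hx)
    · refine Or.inl (key h.symm ((p x).copy (hadjroot h) rfl) (by simpa using hp x) ?_)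
      have := hF.mem_support_of_ne_mem_support_of_adj_of_isPath (hp x)
        (q := (p y).copy (hadjroot h).symm rfl) (by simpa using hp y) h hx
      simpa using this
  · rintro ⟨hne, h | h⟩
    · have := hadjpar x (fun hx => hne (hx.symm.trans h))
      rw [show (p x).penultimate = y from h] at this
      exact this.symm
    · have := hadjpar y (fun hx => hne (h.symm.trans hx))
      rwa [show (p y).penultimate = x from h] at this

end RootedForest

/-! ### Existence of the unicyclic structure -/

section Cycle

variable {V : Type*} [Fintype V] {G : SimpleGraph V} {u : V} {C : G.Walk u u}

theorem toSubgraph_le_of_edges {H : G.Subgraph} (hC : C.IsCycle)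
    (h : ∀ e ∈ C.edges, e ∈ H.edgeSet) : C.toSubgraph ≤ H := by
  have hadj : ∀ a b, C.toSubgraph.Adj a b → H.Adj a b := fun a b hab => by
    have : s(a, b) ∈ C.toSubgraph.edgeSet := hab
    rw [SimpleGraph.Walk.mem_edges_toSubgraph] at this
    exact h _ this
  refine ⟨fun a ha => ?_, fun a b => hadj a b⟩
  have h1 : (C.toSubgraph.neighborSet a).ncard = 2 :=
    hC.ncard_neighborSet_toSubgraph_eq_two ((C.mem_verts_toSubgraph).1 ha)
  obtain ⟨b, hb⟩ : (C.toSubgraph.neighborSet a).Nonempty := by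
    rw [← Set.ncard_pos, h1]
    norm_num
  exact (hadj a b hb).fst_mem

/-- A cycle of `H` is also a cycle of `G`, so it has the same subgraph as `C`, which would put `C`
inside `H`. -/
theorem spanningCoe_isAcyclic_of_not_le
    (honly : ∀ (w : V) (D : G.Walk w w), D.IsCycle → D.toSubgraph = C.toSubgraph)
    {H : G.Subgraph} (hH : ¬ C.toSubgraph ≤ H) : H.spanningCoe.IsAcyclic := by
  intro w p hp
  refine hH ?_
  have hp' := hp.mapLe H.spanningCoe_le
  rw [← honly w _ hp']
  refine toSubgraph_le_of_edges hp' fun e he => ?_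
  rw [SimpleGraph.Walk.edges_mapLe_eq_edges] at he
  have := p.edges_subset_edgeSet he
  rwa [SimpleGraph.Subgraph.edgeSet_spanningCoe] at this

theorem reachable_cycle_deleteEdges (hC : C.IsCycle) {a b : V} (ha : a ∈ C.toSubgraph.verts)
    (hb : b ∈ C.toSubgraph.verts) (e : Sym2 V) :
    (C.toSubgraph.spanningCoe.deleteEdges {e}).Reachable a b := by
  have hE : ∀ e ∈ C.edges, e ∈ C.toSubgraph.spanningCoe.edgeSet := fun e he => by
    rwa [SimpleGraph.Subgraph.edgeSet_spanningCoe, SimpleGraph.Walk.mem_edges_toSubgraph]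
  have h1 := (hC.transfer hE).isCircuit.isTrail
  refine SimpleGraph.isEdgeReachable_two.1 (h1.isEdgeReachable_two ?_ ?_) e
  · rw [SimpleGraph.Walk.support_transfer]
    exact (C.mem_verts_toSubgraph).1 ha
  · rw [SimpleGraph.Walk.support_transfer]
    exact (C.mem_verts_toSubgraph).1 hb

theorem exists_unicyclic (hC : C.IsCycle) (hodd : Odd C.length)
    (honly : ∀ (w : V) (D : G.Walk w w), D.IsCycle → D.toSubgraph = C.toSubgraph) :
    Nonempty (Unicyclic C.toSubgraph) := by
  classical
  have hacyc : ∀ H : G.Subgraph, ¬ C.toSubgraph ≤ H → H.spanningCoe.IsAcyclic :=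
    fun H => spanningCoe_isAcyclic_of_not_le honly
  have hlen : 0 < C.edges.length := by
    rw [SimpleGraph.Walk.length_edges]
    exact hodd.pos
  obtain ⟨e, he⟩ := List.exists_mem_of_length_pos hlen
  have heC : e ∈ C.toSubgraph.edgeSet := C.mem_edges_toSubgraph.2 he
  have hnotle : ∀ s : Set (Sym2 V), e ∈ s →
      ¬ C.toSubgraph ≤ (⊤ : G.Subgraph).deleteEdges s := by
    intro s hs h
    induction e with
    | _ a b =>
      have := h.2 heC
      simp [hs] at this
  have hspan : ∀ s : Set (Sym2 V),
      ((⊤ : G.Subgraph).deleteEdges s).spanningCoe = G.deleteEdges s := fun s => by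
    rw [← SimpleGraph.Subgraph.deleteEdges_spanningCoe_eq, SimpleGraph.Subgraph.spanningCoe_top]
  have hF : (G.deleteEdges C.toSubgraph.edgeSet).IsAcyclic := by
    rw [← hspan]
    exact hacyc _ (hnotle _ heC)
  have hF' : (G.deleteEdges {e}).IsAcyclic := by
    rw [← hspan]
    exact hacyc _ (hnotle _ rfl)
  -- A path off the cycle and a path along the cycle avoiding `e` both lie in the forest without
  -- `e`, so they coincide; but they share no edge.
  have hS : ∀ a ∈ C.toSubgraph.verts, ∀ b ∈ C.toSubgraph.verts,
      (G.deleteEdges C.toSubgraph.edgeSet).Reachable a b → a = b := by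
    intro a ha b hb hab
    by_contra hne
    obtain ⟨p, hp⟩ := hab.exists_isPath
    obtain ⟨q, hq⟩ := (reachable_cycle_deleteEdges hC ha hb e).exists_isPath
    have h1 : G.deleteEdges C.toSubgraph.edgeSet ≤ G.deleteEdges {e} :=
      SimpleGraph.deleteEdges_anti (Set.singleton_subset_iff.2 heC)
    have h2 : C.toSubgraph.spanningCoe.deleteEdges {e} ≤ G.deleteEdges {e} :=
      SimpleGraph.deleteEdges_mono C.toSubgraph.spanningCoe_le
    have h3 := (hF'.subsingleton_path a b).elim ⟨p.mapLe h1, hp.mapLe h1⟩ ⟨q.mapLe h2, hq.mapLe h2⟩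
    rw [Subtype.mk.injEq] at h3
    have h4 := congrArg SimpleGraph.Walk.edges h3
    rw [SimpleGraph.Walk.edges_mapLe_eq_edges, SimpleGraph.Walk.edges_mapLe_eq_edges] at h4
    have h5 : 0 < p.edges.length := by
      rw [SimpleGraph.Walk.length_edges]
      refine Nat.pos_of_ne_zero fun h0 => hne ?_
      exact (SimpleGraph.Walk.length_eq_zero_iff.1 h0).eq
    obtain ⟨f, hf⟩ := List.exists_mem_of_length_pos h5
    have h6 := p.edges_subset_edgeSet hf
    have h7 := q.edges_subset_edgeSet (h4 ▸ hf)
    rw [SimpleGraph.edgeSet_deleteEdges] at h6 h7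
    rw [SimpleGraph.Subgraph.edgeSet_spanningCoe] at h7
    exact h6.2 h7.1
  obtain ⟨R, hRS, hR⟩ := exists_rooting hF hS
  refine ⟨{ R with
    adj_iff := fun x y => ?_
    par_cycle := hRS
    ncard_neighborSet := fun x hx =>
      hC.ncard_neighborSet_toSubgraph_eq_two ((C.mem_verts_toSubgraph).1 hx)
    odd_edges := ?_
    acyclic := hacyc
    cut := ?_ }⟩
  · rw [← hR, SimpleGraph.deleteEdges_adj, SimpleGraph.Subgraph.mem_edgeSet]
    constructor
    · intro h
      by_cases hc : C.toSubgraph.Adj x y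
      · exact Or.inl hc
      · exact Or.inr ⟨h, hc⟩
    · rintro (h | h)
      · exact h.adj_sub
      · exact h.1
  · have h1 : C.toSubgraph.edgeSet = ↑C.edges.toFinset := by
      ext f
      simp
    rw [h1, Set.ncard_coe_finset, List.toFinset_card_of_nodup hC.isCircuit.isTrail.edges_nodup,
      SimpleGraph.Walk.length_edges]
    exact hodd
  · intro S a b hab
    by_contra! hc
    obtain ⟨h1, h2⟩ := hc
    obtain ⟨y, hy, hyS⟩ := Set.not_subset.1 h1
    obtain ⟨x, hx, hxS⟩ := Set.not_disjoint_iff.1 h2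
    obtain ⟨w⟩ := reachable_cycle_deleteEdges hC hx hy s(a, b)
    obtain ⟨d, _, hd1, hd2⟩ := w.exists_boundary_dart S hxS hyS
    have hd := d.adj
    rw [SimpleGraph.deleteEdges_adj] at hd
    obtain ⟨h3, h4⟩ := hab d.fst hd1 d.snd hd2 hd.1
    exact hd.2 (by rw [h3, h4]; rfl)

end Cycle

/-! ### Degrees and telescoping vertices -/

namespace Unicyclic

variable {V : Type*} [Fintype V] {G : SimpleGraph V} {C : G.Subgraph} {R : Unicyclic C}
  {H K : G.Subgraph} {x y t A B : V}

theorem below_mono (h : K ≤ H) (hb : R.Below (R.branch K) x y) : R.Below (R.branch H) x y := by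
  induction hb with
  | refl => exact Relation.ReflTransGen.refl
  | tail _ hab ih =>
    refine ih.parent ?_
    rw [mem_children_branch] at hab ⊢
    exact ⟨hab.1, h.2 hab.2⟩

/-- The attached tree of a vertex of the cycle consists of its descendants. -/
theorem mem_attachedTree (R : Unicyclic C) (hA : A ∈ C.verts) :
    x ∈ attachedTree C A ↔ R.Below (R.branch ⊤) x A := by
  constructor
  · rintro ⟨w⟩
    have key : ∀ {a x : V} (_ : (G.deleteEdges C.edgeSet).Walk a x),
        R.Below (R.branch ⊤) a A → R.Below (R.branch ⊤) x A := by
      intro a x w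
      induction w with
      | nil => exact id
      | @cons a b c h w ih =>
        intro ha
        refine ih ?_
        rw [SimpleGraph.deleteEdges_adj] at h
        rcases adj_cases (R := R) (H := ⊤) h.1 with hc | hc | hc
        · exact absurd hc h.2
        · rcases Relation.ReflTransGen.cases_head ha with rfl | ⟨d, hd, hdA⟩
          · exact absurd (Rooting.mem_children.1 hc).1 (notMem_branch_of_mem_cycle hA)
          · have : d = b := (mem_children_branch.1 hd).1.symm.trans (mem_children_branch.1 hc).1
            exact this ▸ hdA
        · exact Relation.ReflTransGen.head hc ha
    exact key w Relation.ReflTransGen.refl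
  · intro h
    change (G.deleteEdges C.edgeSet).Reachable A x
    induction h using Relation.ReflTransGen.head_induction_on with
    | refl => exact SimpleGraph.Reachable.refl _
    | @head a b hab _ ih =>
      refine ih.trans (SimpleGraph.Adj.reachable ?_)
      rw [SimpleGraph.deleteEdges_adj]
      refine ⟨(mem_children_branch.1 hab).2.symm.adj_sub, fun h => ?_⟩
      exact notMem_branch_of_mem_cycle (SimpleGraph.Subgraph.Adj.snd_mem h)
        (Rooting.mem_children.1 hab).1

theorem ncard_neighborSet_top (v : V) [Fintype (G.neighborSet v)] :
    ((⊤ : G.Subgraph).neighborSet v).ncard = G.degree v := by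
  rw [← SimpleGraph.card_neighborFinset_eq_degree, ← Set.ncard_coe_finset]
  congr 1
  ext w
  simp

theorem odd_degree_iff (v : V) [Fintype (G.neighborSet v)] :
    Odd (G.degree v) ↔ degParity (⊤ : G.Subgraph) v = 1 := by
  unfold degParity
  rw [natCast_zmod_two_eq_one, Nat.odd_iff, ncard_neighborSet_top]

/-- The vertex of the cycle below a telescoping vertex of odd degree. -/
theorem oddShift_of_isTelescoping (R : Unicyclic C) (ht : IsTelescoping C t)
    (hd : degParity (⊤ : G.Subgraph) t = 1) : ∃ A ∈ C.verts, OddShift (R.treeCode ⊤ A) := by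
  obtain ⟨A, hA, htA, K, ⟨hK, hr⟩, hset⟩ := ht
  refine ⟨A, hA, ?_⟩
  rw [R.mem_attachedTree hA] at htA
  have hAK : A ∈ K.verts := by
    have : A ∈ attachedTree C A ∩ connectedTo C K := by rw [hset]; rfl
    exact this.2.1
  have hle : K ≤ (⊤ : G.Subgraph).deleteVerts {t} := by
    clear hr hset hAK
    induction hK with
    | refl => exact le_rfl
    | tail _ h ih => exact h.lt.le.trans ih
  have hne : t ≠ A := fun h => (hle.1 hAK).2 h.symm
  have htb := htA.mem hne
  have htC := notMem_cycle_of_mem_branch htb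
  obtain ⟨hCK, -, hcode⟩ := R.reduction_invariant (le_deleteVerts le_top htC) hK
  -- A child of `A` left in `K` would be a second vertex of the tree connected to the cycle.
  have h0 : R.treeCode K A = 0 := by
    rw [R.treeCode_eq_zero_iff_of_isReduced hr, Finset.eq_empty_iff_forall_notMem]
    intro y hy
    have hyA := (mem_children_branch.1 hy).2
    have : y ∈ attachedTree C A ∩ connectedTo C K :=
      ⟨(R.mem_attachedTree hA).2 (below_mono le_top (Rooting.below_of_mem_children hy)),
        hyA.fst_mem, A, hA, hAK, SimpleGraph.Adj.reachable hyA⟩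
    rw [hset] at this
    exact hyA.ne this
  have h1 := (deletion_deleteVerts (R := R) (H := ⊤) t).oddShift (x := A) ?_ htA hne
  · have h2 := hcode A hA
    rw [h0] at h2
    unfold treeCode at h2 ⊢
    rwa [← h2, add_zero] at h1
  · rw [degParity_of_mem_branch htb] at hd
    simpa [treeCode] using hd

/-- An odd shift lowers its own code to zero. The deletion realising this is telescoping, because
the code stays zero under reduction and thus `A` ends up without children. -/
theorem exists_isTelescoping (hA : A ∈ C.verts) (ho : OddShift (R.treeCode ⊤ A)) :
    ∃ t, IsTelescoping C t ∧ degParity (⊤ : G.Subgraph) t = 1 := by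
  obtain ⟨t, ht, htA, hb, hd, hc⟩ := exists_odd_deletion (q := 0) (pos_iff.2 ho.ne_zero)
    (by rw [add_zero]; exact ho)
  refine ⟨t, ⟨A, hA, (R.mem_attachedTree hA).2 hb, ?_⟩, hd⟩
  obtain ⟨K, hK⟩ := exists_reducesTo ((⊤ : G.Subgraph).deleteVerts {t})
  refine ⟨K, hK, ?_⟩
  obtain ⟨hCK, -, hcode⟩ :=
    R.reduction_invariant (le_deleteVerts le_top (notMem_cycle_of_mem_branch ht)) hK.1
  have hempty := (R.treeCode_eq_zero_iff_of_isReduced hK.2 A).1 (by rw [hcode A hA, hc])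
  apply Set.Subset.antisymm
  · rintro x ⟨hx, -, c, hcC, -, ⟨w⟩⟩
    rw [R.mem_attachedTree hA] at hx
    by_contra hxA
    -- A walk in `K` starting strictly below `A` stays there: it could leave only through a child of
    -- `A`, and none remains.
    have key : ∀ {x c : V} (_ : K.spanningCoe.Walk x c), R.Below (R.branch ⊤) x A ∧ x ≠ A →
        R.Below (R.branch ⊤) c A ∧ c ≠ A := by
      intro x c w
      induction w with
      | nil => exact id
      | @cons x y c h w ih =>
        rintro ⟨hx, hxA⟩
        refine ih ?_
        rcases adj_cases (R := R) (H := K) h with h | h | h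
        · exact absurd h.fst_mem (branch_notMem_cycle hx hxA)
        · rcases Relation.ReflTransGen.cases_head hx with hxA' | ⟨u, hu, huA⟩
          · exact absurd hxA' hxA
          · have : u = y := (mem_children_branch.1 hu).1.symm.trans (mem_children_branch.1 h).1
            subst this
            refine ⟨huA, ?_⟩
            rintro rfl
            rw [hempty] at h
            simp at h
        · have hxy : R.Below (R.branch ⊤) y x :=
            below_mono le_top (Rooting.below_of_mem_children h)
          refine ⟨hxy.trans hx, ?_⟩
          rintro rfl
          exact notMem_branch_of_mem_cycle hA (Rooting.mem_children.1 h).1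
    obtain ⟨h1, h2⟩ := key w ⟨hx, hxA⟩
    exact branch_notMem_cycle h1 h2 hcC
  · rintro x rfl
    exact ⟨(R.mem_attachedTree hA).2 Relation.ReflTransGen.refl, hCK.1 hA, x, hA, hCK.1 hA,
      SimpleGraph.Reachable.refl _⟩

theorem degree_eq_two_add (R : Unicyclic C) (hA : A ∈ C.verts) [Fintype (G.neighborSet A)] :
    G.degree A = 2 + (R.children (R.branch ⊤) A).card := by
  rw [← ncard_neighborSet_top, ncard_neighborSet_of_mem_cycle le_top hA]

theorem degree_eq_two_iff (R : Unicyclic C) (hred : IsReduced (⊤ : G.Subgraph)) (hA : A ∈ C.verts)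
    [Fintype (G.neighborSet A)] : G.degree A = 2 ↔ R.treeCode ⊤ A = 0 := by
  rw [R.treeCode_eq_zero_iff_of_isReduced hred, R.degree_eq_two_add hA, ← Finset.card_eq_zero]
  omega

theorem two_lt_degree_iff (R : Unicyclic C) (hred : IsReduced (⊤ : G.Subgraph)) (hA : A ∈ C.verts)
    [Fintype (G.neighborSet A)] : 2 < G.degree A ↔ R.treeCode ⊤ A ≠ 0 := by
  rw [Ne, ← R.degree_eq_two_iff hred hA, R.degree_eq_two_add hA]
  omega

end Unicyclic
end GraphTakeAway

open GraphTakeAway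
theorem corollary1p4 {V : Type*} [Fintype V] (G : SimpleGraph V) [DecidableRel G.Adj]
    {u : V} (C : G.Walk u u) (hC : C.IsCycle) (hodd : Odd C.length)
    (honly : ∀ (w : V) (D : G.Walk w w), D.IsCycle → D.toSubgraph = C.toSubgraph)
    (hred : IsReduced (⊤ : G.Subgraph)) :
    nimValue (⊤ : G.Subgraph) = 0 ↔
      ((∀ v ∈ C.support, G.degree v = 2) ∧ parity (⊤ : G.Subgraph) = 3) ∨
      ((∃! v, v ∈ C.support ∧ 2 < G.degree v) ∧ parity (⊤ : G.Subgraph) = 0 ∧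
        ¬ ∃ t, IsTelescoping C.toSubgraph t ∧ Odd (G.degree t)) ∨
      ((∃ v ∈ C.support, ∃ w ∈ C.support, v ≠ w ∧ 2 < G.degree v ∧ 2 < G.degree w) ∧
        parity (⊤ : G.Subgraph) = 0) := by
  obtain ⟨R⟩ := exists_unicyclic hC hodd honly
  have hmem : ∀ v, v ∈ C.support ↔ v ∈ C.toSubgraph.verts := fun v =>
    C.mem_verts_toSubgraph.symm
  rw [R.nimValue_eq_zero_iff_zeroPosition, parity_eq_zero_iff, parity_eq_three_iff]
  simp only [hmem]
  constructor
  · rintro (⟨hv, he, hs⟩ | ⟨hv, he, -, hc⟩)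
    · obtain ⟨A, hA, hA0, hAs⟩ := hs le_top
      have hdA := (R.two_lt_degree_iff hred hA).2 hA0
      by_cases hB : ∃ B ∈ C.toSubgraph.verts, B ≠ A ∧ R.treeCode ⊤ B ≠ 0
      · obtain ⟨B, hB, hne, hB0⟩ := hB
        exact Or.inr (Or.inr ⟨⟨A, hA, B, hB, hne.symm, hdA,
          (R.two_lt_degree_iff hred hB).2 hB0⟩, hv, he⟩)
      · refine Or.inr (Or.inl ⟨⟨A, ⟨hA, hdA⟩, ?_⟩, ⟨hv, he⟩, ?_⟩)
        · rintro B ⟨hBC, hdB⟩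
          by_contra hne
          exact hB ⟨B, hBC, hne, (R.two_lt_degree_iff hred hBC).1 hdB⟩
        · rintro ⟨t, ht, hd⟩
          -- A telescoping vertex of odd degree makes some code an odd shift. At `A`, sturdiness
          -- then yields a second nontrivial tree; at any other vertex that tree is itself a second
          -- one.
          obtain ⟨A', hA', ho⟩ := R.oddShift_of_isTelescoping ht
            ((Unicyclic.odd_degree_iff t).1 hd)
          by_cases hAA : A' = A
          · exact hB (hAs (hAA ▸ ho))
          · exact hB ⟨A', hA', hAA, ho.ne_zero⟩
    · exact Or.inl ⟨fun v hv => (R.degree_eq_two_iff hred hv).2 (hc v hv), hv, he⟩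
  · rintro (⟨hc, hv, he⟩ | ⟨⟨A, ⟨hA, hdA⟩, -⟩, ⟨hv, he⟩, ht⟩ |
      ⟨⟨A, hA, B, hB, hne, hdA, hdB⟩, hv, he⟩)
    · exact Or.inr ⟨hv, he, le_top, fun A hA => (R.degree_eq_two_iff hred hA).1 (hc A hA)⟩
    · refine Or.inl ⟨hv, he, fun _ => ⟨A, hA, (R.two_lt_degree_iff hred hA).1 hdA, fun ho => ?_⟩⟩
      obtain ⟨t, htel, hd⟩ := Unicyclic.exists_isTelescoping hA ho
      exact absurd ⟨t, htel, (Unicyclic.odd_degree_iff t).2 hd⟩ ht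
    · exact Or.inl ⟨hv, he, fun _ => ⟨A, hA, (R.two_lt_degree_iff hred hA).1 hdA, fun _ =>
        ⟨B, hB, hne.symm, (R.two_lt_degree_iff hred hB).1 hdB⟩⟩⟩
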